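/- **Setting.** Let $M$ be a connected smooth $n$-manifold (Hausdorff, second countable). A *singular foliation* $\mathcal F$ of $M$ is a partition of $M$ into connected immersed submanifolds (the *leaves*) such that the module $\mathfrak X(\mathcal F)$ of smooth vector fields tangent to the leaves is transitive on each leaf: every vector in the tangent space $T_xL_x$ of the leaf $L_x$ through $x$ is the value at $x$ of some $X\in\mathfrak X(\mathcal F)$. Put $$\mathfrak L(\mathcal F)=\{X\in\mathfrak X(M): [X,\mathfrak X(\mathcal F)]\subset\mathfrak X(\mathcal F)\},\qquad \mathfrak l(\mathcal F)=\mathfrak L(\mathcal F)/\mathfrak X(\mathcal F)$$ (*foliate* and *transverse* vector fields; both notions also make sense on open subsets, and for germs). $\mathcal F$ is a complete *singular Riemannian foliation* if $M$ carries a complete Riemannian metric that is *adapted* to $\mathcal F$: every geodesic that is perpendicular to a leaf at one point is perpendicular to all the leaves it meets. Fix such a metric. The *strata* are the unions $\Sigma_r$ of the leaves of dimension $r$; the *regular stratum* $\Sigma_{\mathrm{reg}}$ is the one of maximal leaf dimension $\dim\mathcal F$. On each stratum the metric induces the transverse metric $g^T_r$, the inner product of the components of tangent vectors of $\Sigma_r$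 perpendicular to the leaves. A transverse vector field is *Killing* if the local flows of its foliate representatives preserve $g_r^T$ on every stratum $\Sigma_r$. **Molino sheaf.** With $q=n-\dim\mathcal F$, the regular foliation $\mathcal F_{\mathrm{reg}}=\mathcal F|_{\Sigma_{\mathrm{reg}}}$ is given by submersions $\pi_i:U_i\to\mathbb R^q$ with connected fibers, defined on open sets, with $\ker d\pi_i$ tangent to the leaves. Its holonomy pseudogroup $\mathcal H$, acting on the disjoint union of the images $\pi_i(U_i)$, is generated by the local diffeomorphisms $h$ with $h\circ\pi_i=\pi_j$. Let $\overline{\mathcal H}$ be the pseudogroup of local diffeomorphisms that are locally $C^1$-limits of elements of $\mathcal H$. The Molino sheaf $\mathscr C_{\mathrm{reg}}$ of $\mathcal F_{\mathrm{reg}}$ is the sheaf of those transverse vector fields that locally project, under the $\pi_i$, to vector fields whose local flows consist of elements of $\overline{\mathcal H}$. The Molino sheaf $\mathscr C_{\mathcal F}$ is the extension of $\mathscr C_{\mathrm{reg}}$ to $M$, whose sections over an open set $U$ are the sections of $\mathscr C_{\mathrm{reg}}$ over $U\cap\Sigma_{\mathrm{reg}}$. The *structural algebra* $\mathfrak a$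 of $\mathcal F$ is the opposite Lie algebra of the stalk of $\mathscr C_{\mathrm{reg}}$. $\mathcal F$ is a *singular Killing foliation* if it is a complete singular Riemannian foliation such that * $\mathscr C_{\mathcal F}$ is a sheaf of germs of transverse Killing vector fields: for every open $U\subset M$, each section of $\mathscr C_{\mathrm{reg}}$ over $U\cap\Sigma_{\mathrm{reg}}$ extends, near every point of $U$, to a smooth transverse Killing vector field; * $\mathscr C_{\mathcal F}$ is a globally constant sheaf of Lie algebras: some Lie algebra of global sections is mapped bijectively onto the stalk at every point of $M$. **$\mathfrak g^\star$-algebras.** A form $\omega\in\Omega(M)$ is *basic* if $\iota_X\omega=0$ and $\mathcal L_X\omega=0$ for all $X\in\mathfrak X(\mathcal F)$; $\Omega(\mathcal F)$ is the space of basic forms. For a real Lie algebra $\mathfrak g$, a *$\mathfrak g^\star$-algebra* is a $\mathbb Z$-graded, graded-commutative, unital differential algebra $(A,d)$ over $\mathbb R$ with $d$ of degree $1$, together with derivations $\mathcal L_X$ of degree $0$ and $\iota_X$ of degree $-1$, linear in $X\in\mathfrak g$, such that for all $X,Y\in\mathfrak g$ $$\iota_X^2=0,\quad [\mathcal L_X,\mathcal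 L_Y]=\mathcal L_{[X,Y]},\quad [\mathcal L_X,\iota_Y]=\iota_{[X,Y]},\quad \mathcal L_X=d\,\iota_X+\iota_X\,d .$$ **Proposition.** Let $\mathcal F$ be a singular Killing foliation of $M$, with structural algebra $\mathfrak a$. 1. There is an injective homomorphism of Lie algebras $\mu:\mathfrak a\to\mathfrak l(\mathcal F)$, that is, a transverse infinitesimal action of $\mathfrak a$ on $\mathcal F$, whose image is the space $\mathscr C_{\mathcal F}(M)$ of global sections of the Molino sheaf. 2. For every such $\mu$, the basic forms, with the wedge product, the unit $1$ and the exterior derivative $d$ of $\Omega(M)$, form an $\mathfrak a^\star$-algebra in which $$\mathcal L_X\omega=\mathcal L_{\tilde X}\omega,\qquad \iota_X\omega=\iota_{\tilde X}\omega\qquad(X\in\mathfrak a,\ \omega\in\Omega(\mathcal F))$$ for every foliate vector field $\tilde X\in\mathfrak L(\mathcal F)$ that represents $\mu(X)$. In particular these operators preserve $\Omega(\mathcal F)$ and do not depend on the choice of $\tilde X$. -/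

import Mathlib

open Set Filter Topology Bundle
open scoped Manifold ContDiff

universe u

set_option linter.unusedSectionVars false

noncomputable section

/-- The algebra `C^∞(M)` of smooth functions on `M`. -/
abbrev SmoothFun (n : ℕ) (M : Type*) [TopologicalSpace M]
    [ChartedSpace (EuclideanSpace ℝ (Fin n)) M] : Type _ :=
  ContMDiffMap (𝓡 n) 𝓘(ℝ, ℝ) M ℝ ∞

/-- The smooth vector fields `𝔛(M)` on `M`. -/
abbrev VField (n : ℕ) (M : Type*) [TopologicalSpace M]
    [ChartedSpace (EuclideanSpace ℝ (Fin n)) M] [IsManifold (𝓡 n) ∞ M] : Type _ :=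
  ContMDiffSection (𝓡 n) (EuclideanSpace ℝ (Fin n)) ∞ (fun x : M => TangentSpace (𝓡 n) x)

/-- The (not necessarily continuous) field `X` of tangent vectors is smooth on `U`. -/
def SmoothFieldOn {n : ℕ} {M : Type*} [TopologicalSpace M]
    [ChartedSpace (EuclideanSpace ℝ (Fin n)) M] [IsManifold (𝓡 n) ∞ M]
    (U : Set M) (X : (x : M) → TangentSpace (𝓡 n) x) : Prop :=
  ContMDiffOn (𝓡 n) (𝓡 n).tangent ∞ (fun x => (⟨x, X x⟩ : TangentBundle (𝓡 n) M)) U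

section
variable {n : ℕ} {M : Type*} [TopologicalSpace M]
    [ChartedSpace (EuclideanSpace ℝ (Fin n)) M] [IsManifold (𝓡 n) ∞ M]
variable {U V : Set M} {X Y Z : (x : M) → TangentSpace (𝓡 n) x}

lemma SmoothFieldOn.at (h : SmoothFieldOn U X) (hU : IsOpen U) {x : M} (hx : x ∈ U) :
    ContMDiffAt (𝓡 n) (𝓡 n).tangent ∞ (fun x => (⟨x, X x⟩ : TangentBundle (𝓡 n) M)) x :=
  ContMDiffOn.contMDiffAt h (hU.mem_nhds hx)

lemma ContMDiffAt.vbracket {x : M}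
    (hX : ContMDiffAt (𝓡 n) (𝓡 n).tangent ∞ (fun x => (⟨x, X x⟩ : TangentBundle (𝓡 n) M)) x)
    (hY : ContMDiffAt (𝓡 n) (𝓡 n).tangent ∞ (fun x => (⟨x, Y x⟩ : TangentBundle (𝓡 n) M)) x) :
    ContMDiffAt (𝓡 n) (𝓡 n).tangent ∞
      (fun x => (⟨x, VectorField.mlieBracket (𝓡 n) X Y x⟩ : TangentBundle (𝓡 n) M)) x := by
  have : IsManifold (𝓡 n) (minSmoothness ℝ 2) M := by
    simp only [minSmoothness_of_isRCLikeNormedField]; infer_instance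
  have : IsManifold (𝓡 n) (((⊤ : ℕ∞) : WithTop ℕ∞) + 1) M := by
    change IsManifold (𝓡 n) ∞ M; infer_instance
  exact ContMDiffAt.mlieBracket_vectorField (m := ⊤) (n := ⊤) hX hY (by simp)

lemma SmoothFieldOn.bracket (hU : IsOpen U) (hX : SmoothFieldOn U X) (hY : SmoothFieldOn U Y) :
    SmoothFieldOn U (VectorField.mlieBracket (𝓡 n) X Y) :=
  fun _ hx => ((hX.at hU hx).vbracket (hY.at hU hx)).contMDiffWithinAt

lemma bracket_jacobi {x : M}
    (hX : ContMDiffAt (𝓡 n) (𝓡 n).tangent ∞ (fun x => (⟨x, X x⟩ : TangentBundle (𝓡 n) M)) x)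
    (hY : ContMDiffAt (𝓡 n) (𝓡 n).tangent ∞ (fun x => (⟨x, Y x⟩ : TangentBundle (𝓡 n) M)) x)
    (hZ : ContMDiffAt (𝓡 n) (𝓡 n).tangent ∞ (fun x => (⟨x, Z x⟩ : TangentBundle (𝓡 n) M)) x) :
    VectorField.mlieBracket (𝓡 n) X (VectorField.mlieBracket (𝓡 n) Y Z) x =
      VectorField.mlieBracket (𝓡 n) (VectorField.mlieBracket (𝓡 n) X Y) Z x +
      VectorField.mlieBracket (𝓡 n) Y (VectorField.mlieBracket (𝓡 n) X Z) x := by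
  have : IsManifold (𝓡 n) (minSmoothness ℝ 3) M := by
    simp only [minSmoothness_of_isRCLikeNormedField]; infer_instance
  have h2 : minSmoothness ℝ 2 ≤ (∞ : WithTop ℕ∞) := by
    simp only [minSmoothness_of_isRCLikeNormedField]; exact WithTop.coe_le_coe.2 le_top
  exact VectorField.leibniz_identity_mlieBracket_apply (hX.of_le h2) (hY.of_le h2) (hZ.of_le h2)

/-- The Lie bracket of vector fields. -/
instance : Bracket (VField n M) (VField n M) :=
  ⟨fun X Y => ⟨VectorField.mlieBracket (𝓡 n) X Y,
    fun x => (X.contMDiff x).vbracket (Y.contMDiff x)⟩⟩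

lemma VField.bracket_apply (X Y : VField n M) (x : M) :
    ⁅X, Y⁆ x = VectorField.mlieBracket (𝓡 n) X Y x := rfl

instance : LieRing (VField n M) where
  add_lie X Y Z := by
    ext x
    exact VectorField.mlieBracket_add_left X.mdifferentiableAt Y.mdifferentiableAt
  lie_add X Y Z := by
    ext x
    exact VectorField.mlieBracket_add_right Y.mdifferentiableAt Z.mdifferentiableAt
  lie_self X := by
    ext x
    have := VectorField.mlieBracket_swap_apply (I := 𝓡 n) (V := X) (W := X) (x := x)
    change VectorField.mlieBracket (𝓡 n) X X x = 0
    have h2 : (2 : ℝ) • VectorField.mlieBracket (𝓡 n) X X x = 0 := by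
      rw [two_smul]; nth_rw 1 [this]; exact neg_add_cancel _
    exact (smul_eq_zero.1 h2).resolve_left two_ne_zero
  leibniz_lie X Y Z := by
    ext x
    exact bracket_jacobi (X.contMDiff x) (Y.contMDiff x) (Z.contMDiff x)

instance : LieAlgebra ℝ (VField n M) where
  lie_smul c X Y := by
    ext x
    exact VectorField.mlieBracket_const_smul_right Y.mdifferentiableAt

instance : Module (SmoothFun n M) (VField n M) where
  smul f X := ⟨fun x => f x • X x, fun x => (f.contMDiff x).smul_section (X.contMDiff x)⟩
  one_smul X := by ext x; exact one_smul ℝ (X x)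
  mul_smul f g X := by ext x; exact mul_smul (f x) (g x) (X x)
  smul_zero f := by ext x; exact smul_zero (f x)
  smul_add f X Y := by ext x; exact smul_add (f x) (X x) (Y x)
  add_smul f g X := by ext x; exact add_smul (f x) (g x) (X x)
  zero_smul X := by ext x; exact zero_smul ℝ (X x)

lemma VField.smul_apply (f : SmoothFun n M) (X : VField n M) (x : M) : (f • X) x = f x • X x := rfl

lemma contMDiff_apply_vfield (X : VField n M) (f : SmoothFun n M) :
    ContMDiff (𝓡 n) 𝓘(ℝ, ℝ) ∞ (fun x => mvfderiv (𝓡 n) f x (X x)) := by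
  have h : ContMDiff (𝓡 n).tangent 𝓘(ℝ, ℝ).tangent ∞ (tangentMap (𝓡 n) 𝓘(ℝ, ℝ) f) :=
    f.contMDiff.contMDiff_tangentMap (by simp)
  exact (contMDiff_snd_tangentBundle_modelSpace ℝ 𝓘(ℝ, ℝ)).comp (h.comp X.contMDiff)

/-- The derivative `X f = df(X)` of a smooth function `f` along a vector field `X`. -/
instance : Bracket (VField n M) (SmoothFun n M) :=
  ⟨fun X f => ⟨fun x => mvfderiv (𝓡 n) f x (X x), contMDiff_apply_vfield X f⟩⟩

lemma VField.lie_fun_apply (X : VField n M) (f : SmoothFun n M) (x : M) :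
    ⁅X, f⁆ x = mvfderiv (𝓡 n) f x (X x) := rfl

lemma VField.lie_smul_right (X Y : VField n M) (f : SmoothFun n M) :
    ⁅X, f • Y⁆ = f • ⁅X, Y⁆ + ⁅X, f⁆ • Y := by
  ext x
  have h := VectorField.mlieBracket_smul_right (I := 𝓡 n) (V := X) (W := Y) (f := f) (x := x)
    (f.contMDiff.mdifferentiableAt (by simp)) Y.mdifferentiableAt
  rw [add_comm] at h
  exact h


lemma exists_cutoff [T2Space M] (hU : IsOpen U) {x : M} (hx : x ∈ U) :
    ∃ ρ : SmoothFun n M, (∀ᶠ y in 𝓝 x, ρ y = 1) ∧ tsupport ρ ⊆ U := by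
  obtain ⟨ρ, hρ⟩ := ((SmoothBumpFunction.nhds_basis_tsupport (I := 𝓡 n) x).mem_iff).1
    (hU.mem_nhds hx)
  exact ⟨⟨ρ, ρ.contMDiff⟩, ρ.eventuallyEq_one, hρ.2⟩

lemma SmoothFieldOn.cutoff (hU : IsOpen U) (hX : SmoothFieldOn U X) (ρ : SmoothFun n M)
    (hρ : tsupport ρ ⊆ U) : SmoothFieldOn V (fun y => ρ y • X y) :=
  (ContMDiffOn.smul_section_of_tsupport (V := fun x : M => TangentSpace (𝓡 n) x)
    ρ.contMDiff.contMDiffOn hU hρ hX).contMDiffOn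

lemma exists_vfield_apply_eq [T2Space M] (x : M) (v : TangentSpace (𝓡 n) x) :
    ∃ Z : VField n M, Z x = v := by
  obtain ⟨s, hs, hsσ⟩ := FiberBundle.exists_contMDiffOn_extend (k := ∞) (𝓡 n)
    (EuclideanSpace ℝ (Fin n)) (V := fun x : M => TangentSpace (𝓡 n) x) v
  obtain ⟨u, hus, hu, hxu⟩ := mem_nhds_iff.1 hs
  obtain ⟨ρ, h1, h2⟩ := exists_cutoff (n := n) hu hxu
  have := SmoothFieldOn.cutoff (V := univ) hu (hsσ.mono hus) ρ h2
  refine ⟨⟨_, contMDiffOn_univ.1 this⟩, ?_⟩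
  simp [h1.self_of_nhds]

lemma SmoothFun.eq_zero_of_smul [T2Space M] (f : SmoothFun n M)
    (h : ∀ Z : VField n M, f • Z = 0) (hn : n ≠ 0) : f = 0 := by
  ext x
  have : Nontrivial (TangentSpace (𝓡 n) x) := by
    have : Nonempty (Fin n) := ⟨⟨0, Nat.pos_of_ne_zero hn⟩⟩
    change Nontrivial (EuclideanSpace ℝ (Fin n))
    infer_instance
  obtain ⟨v, hv⟩ := exists_ne (0 : TangentSpace (𝓡 n) x)
  obtain ⟨Z, hZ⟩ := exists_vfield_apply_eq x v
  have h2 : f x • Z x = 0 := by rw [← VField.smul_apply, h Z]; rfl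
  rw [hZ] at h2
  exact (smul_eq_zero.1 h2).resolve_right hv

lemma VField.add_lie_fun (X Y : VField n M) (f : SmoothFun n M) :
    ⁅X + Y, f⁆ = ⁅X, f⁆ + ⁅Y, f⁆ := by
  ext x; exact map_add (mvfderiv (𝓡 n) f x) (X x) (Y x)

lemma VField.lie_fun_add (X : VField n M) (f g : SmoothFun n M) :
    ⁅X, f + g⁆ = ⁅X, f⁆ + ⁅X, g⁆ := by
  ext x
  have h := mvfderiv_add (I := 𝓡 n) (f.contMDiff.mdifferentiableAt (x := x) (by simp))
    (g.contMDiff.mdifferentiableAt (x := x) (by simp))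
  exact DFunLike.congr_fun h (X x)

lemma VField.lie_lie_fun [T2Space M] (X Y : VField n M) (f : SmoothFun n M) :
    ⁅X, ⁅Y, f⁆⁆ = ⁅⁅X, Y⁆, f⁆ + ⁅Y, ⁅X, f⁆⁆ := by
  rcases eq_or_ne n 0 with rfl | hn
  · have h0 : ∀ (X : VField 0 M) (f : SmoothFun 0 M), ⁅X, f⁆ = 0 := by
      intro X f
      ext x
      have : X x = 0 := by
        have : Subsingleton (TangentSpace (𝓡 0) x) := by
          change Subsingleton (EuclideanSpace ℝ (Fin 0)); infer_instance
        exact Subsingleton.elim _ _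
      rw [VField.lie_fun_apply, this, map_zero]; rfl
    simp [h0]
  · rw [← sub_eq_zero]
    refine SmoothFun.eq_zero_of_smul _ (fun Z => ?_) hn
    have h := leibniz_lie X Y (f • Z)
    simp only [VField.lie_smul_right, lie_add] at h
    rw [leibniz_lie X Y Z, smul_add] at h
    rw [sub_smul, add_smul, sub_eq_zero]
    have := sub_eq_zero.2 h
    rw [← sub_eq_zero, ← this]
    abel

instance [T2Space M] : LieRingModule (VField n M) (SmoothFun n M) where
  add_lie := VField.add_lie_fun
  lie_add := VField.lie_fun_add
  leibniz_lie := VField.lie_lie_fun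

instance [T2Space M] : LieRinehartRing (SmoothFun n M) (VField n M) where
  lie_smul_eq_mul' f g X := by
    ext x; exact map_smul (mvfderiv (𝓡 n) g x) (f x) (X x)
  leibniz_mul_right' X f g := by
    ext x
    have h := mvfderiv_mul (I := 𝓡 n) (f.contMDiff.mdifferentiableAt (x := x) (by simp))
      (g.contMDiff.mdifferentiableAt (x := x) (by simp))
    have h2 := DFunLike.congr_fun h (X x)
    refine h2.trans ?_
    change f x * _ + g x * _ = f x * _ + _ * g x
    rw [mul_comm (g x)]
    rfl
  leibniz_smul_right' X Y f := VField.lie_smul_right X Y f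

/-- Vector fields are a Lie algebra and a `C^∞(M)`-module, acting on `C^∞(M)` by derivations,
with `[X, f Y] = f [X, Y] + (X f) Y`. -/
instance [T2Space M] : LieRinehartAlgebra ℝ (SmoothFun n M) (VField n M) where
  smul_assoc c f X := by ext x; exact mul_smul c (f x) (X x)
  smul_lie c X f := by ext x; exact map_smul (mvfderiv (𝓡 n) f x) c (X x)
  lie_smul c X f := by
    ext x
    have h := mvfderiv_smul (I := 𝓡 n) (a := fun _ => c) mdifferentiableAt_const
      (f.contMDiff.mdifferentiableAt (x := x) (by simp))
    rw [mvfderiv_const] at h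
    refine (DFunLike.congr_fun h (X x)).trans ?_
    simp
    exact Or.inl rfl

end

namespace LRForm
open Function

/-- The `k`-forms: alternating `A`-multilinear maps `L^k → A`. For `A = C^∞(M)` and `L = 𝔛(M)`
this is the space `Ω^k(M)` of differential `k`-forms on `M`, in its standard description as
alternating `C^∞(M)`-multilinear functions of `k` vector fields. The Cartan calculus below is
written in terms of the operations on `C^∞(M)` and `𝔛(M)` only. -/
abbrev Form (A L : Type*) [CommRing A] [LieRing L] [Module A L] (k : ℕ) := L [⋀^Fin k]→ₗ[A] A

open DirectSum in
/-- The space `Ω = ⨁ₖ Ω^k` of all forms. -/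
abbrev Forms (A L : Type*) [CommRing A] [LieRing L] [Module A L] := ⨁ k : ℕ, Form A L k

section
variable {A L : Type*} [CommRing A] [LieRing L] [Module A L] [LieRingModule L A]
  [LieRinehartRing A L] [Algebra ℝ A] [LieAlgebra ℝ L] [LieRinehartAlgebra ℝ A L] {k : ℕ}

lemma smul_lie_right (a : A) (X Y : L) : ⁅a • X, Y⁆ = a • ⁅X, Y⁆ - ⁅Y, a⁆ • X := by
  rw [← lie_skew, LieRinehartRing.leibniz_smul_right, ← lie_skew X Y, smul_neg]; abel

/-- The contraction `(ι_X α)(v₁, …) = α(X, v₁, …)`, which is zero on `0`-forms. -/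
def contr (X : L) : (k : ℕ) → Form A L k →ₗ[A] Form A L (k - 1)
  | 0 => 0
  | _ + 1 => (LinearMap.applyₗ X).comp (AlternatingMap.curryLeftLinearMap)

/-- The Lie derivative
`(L_X α)(v₁, …, v_k) = X (α(v₁, …, v_k)) - ∑ᵢ α(v₁, …, [X, vᵢ], …, v_k)`. -/
def lieDeriv (X : L) (α : Form A L k) : Form A L k where
  toFun v := ⁅X, α v⁆ - ∑ i, α (update v i ⁅X, v i⁆)
  map_update_add' := by
    intro _ v i x y
    obtain rfl : ‹DecidableEq (Fin k)› = instDecidableEqFin k := Subsingleton.elim _ _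
    rw [← Finset.add_sum_erase _ _ (Finset.mem_univ i),
      ← Finset.add_sum_erase _ _ (Finset.mem_univ i),
      ← Finset.add_sum_erase _ _ (Finset.mem_univ i)]
    have : ∀ z, ∑ j ∈ Finset.univ.erase i, α (update (update v i z) j ⁅X, update v i z j⁆) =
        ∑ j ∈ Finset.univ.erase i, α (update (update v j ⁅X, v j⁆) i z) :=
      fun z => Finset.sum_congr rfl fun j hj => by
        rw [update_comm (Finset.ne_of_mem_erase hj).symm, update_of_ne (Finset.ne_of_mem_erase hj)]
    simp only [this, update_idem, update_self, lie_add, α.map_update_add, Finset.sum_add_distrib]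
    abel
  map_update_smul' := by
    intro _ v i a x
    obtain rfl : ‹DecidableEq (Fin k)› = instDecidableEqFin k := Subsingleton.elim _ _
    rw [← Finset.add_sum_erase _ _ (Finset.mem_univ i),
      ← Finset.add_sum_erase _ _ (Finset.mem_univ i)]
    have : ∀ z, ∑ j ∈ Finset.univ.erase i, α (update (update v i z) j ⁅X, update v i z j⁆) =
        ∑ j ∈ Finset.univ.erase i, α (update (update v j ⁅X, v j⁆) i z) :=
      fun z => Finset.sum_congr rfl fun j hj => by
        rw [update_comm (Finset.ne_of_mem_erase hj).symm, update_of_ne (Finset.ne_of_mem_erase hj)]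
    simp only [this, update_idem, update_self, LieRinehartRing.leibniz_smul_right,
      α.map_update_add, α.map_update_smul, smul_eq_mul, ← Finset.mul_sum,
      LieRinehartRing.leibniz_mul_right]
    ring
  map_eq_zero_of_eq' := by
    intro v i j hv hij
    rw [α.map_eq_zero_of_eq v hv hij, lie_zero, zero_sub, neg_eq_zero,
      ← Finset.add_sum_erase _ _ (Finset.mem_univ i),
      ← Finset.add_sum_erase _ _ (Finset.mem_erase.2 ⟨hij.symm, Finset.mem_univ j⟩),
      Finset.sum_eq_zero, add_zero]
    · have h := α.map_swap (update v i ⁅X, v i⁆) hij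
      rw [eq_neg_iff_add_eq_zero, add_comm] at h
      convert h using 3
      ext l
      simp only [comp_apply]
      rcases eq_or_ne l i with rfl | hl
      · rw [Equiv.swap_apply_left, update_of_ne hij, update_of_ne hij.symm, hv]
      rcases eq_or_ne l j with rfl | hl'
      · rw [Equiv.swap_apply_right, update_self, update_self, hv]
      · rw [Equiv.swap_apply_of_ne_of_ne hl hl', update_of_ne hl', update_of_ne hl]
    · intro l hl
      rw [Finset.mem_erase, Finset.mem_erase] at hl
      exact α.map_eq_zero_of_eq _
        (by rw [update_of_ne hl.2.1.symm, update_of_ne hl.1.symm, hv]) hij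

lemma lieDeriv_apply (X : L) (α : Form A L k) (v : Fin k → L) :
    lieDeriv X α v = ⁅X, α v⁆ - ∑ i, α (update v i ⁅X, v i⁆) := rfl

lemma lieDeriv_add (X : L) (α η : Form A L k) :
    lieDeriv X (α + η) = lieDeriv X α + lieDeriv X η := by
  ext v; simp only [lieDeriv_apply, AlternatingMap.add_apply, lie_add, Finset.sum_add_distrib]; abel

lemma lieDeriv_smul (c : ℝ) (X : L) (α : Form A L k) :
    lieDeriv X (c • α) = c • lieDeriv X α := by
  ext v; simp only [lieDeriv_apply, AlternatingMap.smul_apply, lie_smul, ← Finset.smul_sum, smul_sub]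

lemma add_lieDeriv (X Y : L) (α : Form A L k) :
    lieDeriv (X + Y) α = lieDeriv X α + lieDeriv Y α := by
  ext v
  simp only [lieDeriv_apply, AlternatingMap.add_apply, add_lie, α.map_update_add, Finset.sum_add_distrib]; abel

lemma smul_lieDeriv (c : ℝ) (X : L) (α : Form A L k) :
    lieDeriv (c • X) α = c • lieDeriv X α := by
  ext v
  simp only [lieDeriv_apply, AlternatingMap.smul_apply, smul_lie, smul_sub, Finset.smul_sum]
  congr 1
  refine Finset.sum_congr rfl fun i _ => ?_
  rw [← IsScalarTower.algebraMap_smul A c ⁅X, v i⁆, α.map_update_smul, algebraMap_smul]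

/-- The Koszul formula for the exterior derivative,
`∑ᵢ (-1)^i vᵢ (α(v₀, …, v̂ᵢ, …, v_k)) + ∑_{i<j} (-1)^(i+j) α([vᵢ, vⱼ], v₀, …, v̂ᵢ, …, v̂ⱼ, …, v_k)`.
In the second sum the bracket stands in the `i`-th place, which accounts for the factor `(-1)^i`. -/
def koszul (α : Form A L k) (v : Fin (k + 1) → L) : A :=
  ∑ i : Fin (k + 1), (-1 : A) ^ (i : ℕ) * ⁅v i, α (i.removeNth v)⁆ +
    ∑ i : Fin (k + 1), ∑ j ∈ Finset.Ioi i,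
      (-1 : A) ^ (j : ℕ) * α (j.removeNth (update v i ⁅v i, v j⁆))


/-- A form, seen as a real multilinear map. -/
def realForm (α : Form A L k) : L [⋀^Fin k]→ₗ[ℝ] A where
  toMultilinearMap := α.toMultilinearMap.restrictScalars ℝ
  map_eq_zero_of_eq' := fun v _ _ hv hij => α.map_eq_zero_of_eq v hv hij

/-- The map `Y ↦ Y ∘ α + L_Y α`; twice the Koszul formula is its alternatization. -/
def koszulAux (α : Form A L k) : L →ₗ[ℝ] L [⋀^Fin k]→ₗ[ℝ] A where
  toFun Y := ((LieModule.toEnd ℝ L A Y : A →ₗ[ℝ] A).compAlternatingMap (realForm α)) +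
    realForm (lieDeriv Y α)
  map_add' Y Z := by
    ext v
    change ⁅Y + Z, α v⁆ + lieDeriv (Y + Z) α v =
      ⁅Y, α v⁆ + lieDeriv Y α v + (⁅Z, α v⁆ + lieDeriv Z α v)
    rw [add_lieDeriv, add_lie, AlternatingMap.add_apply]; abel
  map_smul' c Y := by
    ext v
    change ⁅c • Y, α v⁆ + lieDeriv (c • Y) α v = c • (⁅Y, α v⁆ + lieDeriv Y α v)
    rw [smul_lieDeriv, smul_lie, AlternatingMap.smul_apply, smul_add]

lemma koszulAux_apply (α : Form A L k) (Y : L) (v : Fin k → L) :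
    koszulAux α Y v = ⁅Y, α v⁆ + lieDeriv Y α v := rfl

lemma alternatize_koszulAux (α : Form A L k) (v : Fin (k + 1) → L) :
    AlternatingMap.alternatizeUncurryFin (koszulAux α) v =
      ∑ i : Fin (k + 1), (-1 : A) ^ (i : ℕ) *
        (⁅v i, α (i.removeNth v)⁆ + lieDeriv (v i) α (i.removeNth v)) := by
  simp only [AlternatingMap.alternatizeUncurryFin_apply, koszulAux_apply, zsmul_eq_mul,
    Int.cast_pow, Int.cast_neg, Int.cast_one]


lemma sum_removeNth (i : Fin (k + 1)) (α : Form A L k) (v : Fin (k + 1) → L) (w : Fin (k + 1) → L) :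
    ∑ j, α (update (i.removeNth v) j (i.removeNth w j)) =
      ∑ j ∈ Finset.univ.erase i, α (i.removeNth (update v j (w j))) := by
  have h : Finset.univ.erase i = Finset.univ.image i.succAbove := by
    ext j
    simp
  rw [h, Finset.sum_image fun _ _ _ _ h => Fin.succAbove_right_injective h]
  exact Finset.sum_congr rfl fun j _ => by
    rw [Fin.removeNth_update_succAbove]; rfl

lemma two_koszul (α : Form A L k) (v : Fin (k + 1) → L) :
    AlternatingMap.alternatizeUncurryFin (koszulAux α) v = 2 * koszul α v := by
  obtain ⟨T, hT⟩ : ∃ T : Fin (k + 1) → Fin (k + 1) → A, ∀ i j, T i j =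
    (-1 : A) ^ (j : ℕ) * α (j.removeNth (update v i ⁅v i, v j⁆)) := ⟨_, fun _ _ => rfl⟩
  have h1 : ∀ i j : Fin (k + 1), j ≠ i →
      (-1 : A) ^ (i : ℕ) * α (i.removeNth (update v j ⁅v i, v j⁆)) = - T j i := by
    intro i j hij
    rw [hT]
    obtain ⟨m, rfl⟩ := Fin.exists_succAbove_eq hij
    rw [Fin.removeNth_update_succAbove, Fin.removeNth_update_succAbove,
      ← lie_skew, ← neg_one_smul A ⁅v _, v i⁆, α.map_update_smul, smul_eq_mul]
    ring
  have h2 : ∀ i j, j ≠ i → T i j = T j i := by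
    intro i j hij
    have := α.neg_one_pow_smul_map_removeNth_add_eq_zero_of_eq
      (v := update (update v i ⁅v i, v j⁆) j ⁅v i, v j⁆) (i := i) (j := j)
      (by rw [update_self, update_of_ne hij.symm, update_self]) hij.symm
    rw [Fin.removeNth_update, update_comm hij.symm, Fin.removeNth_update] at this
    simp only [zsmul_eq_mul, Int.cast_pow, Int.cast_neg, Int.cast_one] at this
    rw [h1 i j hij, ← hT i j] at this
    linear_combination this
  have h3 : ∑ i, ∑ j ∈ Finset.univ.erase i, T i j =
      2 * ∑ i : Fin (k + 1), ∑ j ∈ Finset.Ioi i, T i j := by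
    have h5 : ∀ i : Fin (k + 1), ∑ j ∈ Finset.univ.erase i, T i j =
        ∑ j ∈ Finset.Ioi i, T i j + ∑ j ∈ Finset.Iio i, T j i := by
      intro i
      have : Finset.univ.erase i = Finset.Ioi i ∪ Finset.Iio i := by
        ext j; simp [lt_or_lt_iff_ne, eq_comm]
      rw [this, Finset.sum_union]
      · congr 1
        refine Finset.sum_congr rfl fun j hj => h2 _ _ (Finset.mem_Iio.1 hj).ne
      · rw [Finset.disjoint_left]
        intro j h h'
        exact absurd (Finset.mem_Iio.1 h') (Finset.mem_Ioi.1 h).asymm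
    simp only [h5, Finset.sum_add_distrib]
    rw [Finset.sum_comm' (s := Finset.univ) (t := fun i => Finset.Iio i) (t' := Finset.univ)
      (s' := fun i => Finset.Ioi i) (by simp)]
    ring
  have h6 : ∀ i : Fin (k + 1), (-1 : A) ^ (i : ℕ) *
      ∑ j, α (update (i.removeNth v) j ⁅v i, i.removeNth v j⁆) =
      - ∑ j ∈ Finset.univ.erase i, T i j := by
    intro i
    rw [show ∑ j, α (update (i.removeNth v) j ⁅v i, i.removeNth v j⁆) = _ from
        sum_removeNth i α v (fun j => ⁅v i, v j⁆), Finset.mul_sum, ← Finset.sum_neg_distrib]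
    refine Finset.sum_congr rfl fun j hj => ?_
    rw [h1 i j (Finset.ne_of_mem_erase hj), h2 i j (Finset.ne_of_mem_erase hj)]
  rw [alternatize_koszulAux]
  simp only [lieDeriv_apply, mul_add, mul_sub, Finset.sum_add_distrib, Finset.sum_sub_distrib,
    koszul, h6, Finset.sum_neg_distrib, h3, ← hT]
  ring

lemma removeNth_swap_aux (α : Form A L k) (v : Fin (k + 1) → L) (X : L) {p i : Fin (k + 1)}
    (h : i ≠ p) : (-1 : A) ^ (p : ℕ) * α (p.removeNth (update v i X)) +
      (-1 : A) ^ (i : ℕ) * α (i.removeNth (update v p X)) = 0 := by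
  have := α.neg_one_pow_smul_map_removeNth_add_eq_zero_of_eq
    (v := update (update v p X) i X) (i := p) (j := i)
    (by rw [update_self, update_of_ne h.symm, update_self]) h.symm
  rw [Fin.removeNth_update, update_comm h.symm, Fin.removeNth_update] at this
  simpa only [zsmul_eq_mul, Int.cast_pow, Int.cast_neg, Int.cast_one] using this

lemma removeNth_update_smul (α : Form A L k) (v : Fin (k + 1) → L) (a : A) (X : L)
    {p i : Fin (k + 1)} (h : p ≠ i) :
    α (i.removeNth (update v p (a • X))) = a * α (i.removeNth (update v p X)) := by
  obtain ⟨m, rfl⟩ := Fin.exists_succAbove_eq h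
  rw [Fin.removeNth_update_succAbove, Fin.removeNth_update_succAbove, α.map_update_smul,
    smul_eq_mul]

lemma two_mul_inj {b c : A} (h : 2 * b = 2 * c) : b = c := by
  have : (2 : ℝ) • b = (2 : ℝ) • c := by
    rw [Algebra.smul_def, Algebra.smul_def, map_ofNat]; exact h
  have h2 := congrArg (fun x => (2⁻¹ : ℝ) • x) this
  simpa [smul_smul] using h2

lemma smul_lieDeriv_fun (α : Form A L k) (a : A) (X : L) (v : Fin k → L) :
    lieDeriv (a • X) α v = a * lieDeriv X α v + ∑ i, ⁅v i, a⁆ * α (update v i X) := by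
  simp only [lieDeriv_apply, LieRinehartRing.lie_smul_eq_mul, smul_lie_right, sub_eq_add_neg,
    α.map_update_add, ← neg_smul, α.map_update_smul, Finset.sum_add_distrib, smul_eq_mul,
    ← Finset.mul_sum, neg_mul, Finset.sum_neg_distrib]
  ring

lemma koszul_smul (α : Form A L k) (a : A) (X : L) (v : Fin (k + 1) → L) (p : Fin (k + 1)) :
    koszul α (update v p (a • X)) = a * koszul α (update v p X) := by
  apply two_mul_inj
  rw [← two_koszul, mul_left_comm, ← two_koszul, alternatize_koszulAux, alternatize_koszulAux,
    ← Finset.add_sum_erase _ _ (Finset.mem_univ p), ← Finset.add_sum_erase _ _ (Finset.mem_univ p)]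
  have e : ∀ i ∈ Finset.univ.erase p, (-1 : A) ^ (i : ℕ) *
      (⁅update v p (a • X) i, α (i.removeNth (update v p (a • X)))⁆ +
        lieDeriv (update v p (a • X) i) α (i.removeNth (update v p (a • X)))) =
      a * ((-1 : A) ^ (i : ℕ) * (⁅update v p X i, α (i.removeNth (update v p X))⁆ +
        lieDeriv (update v p X i) α (i.removeNth (update v p X)))) -
      (-1 : A) ^ (p : ℕ) * (⁅v i, a⁆ * α (p.removeNth (update v i X))) := by
    intro i hi
    have hi := Finset.ne_of_mem_erase hi
    rw [update_of_ne hi, update_of_ne hi, removeNth_update_smul _ _ _ _ hi.symm,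
      removeNth_update_smul _ _ _ _ hi.symm, LieRinehartRing.leibniz_mul_right, smul_eq_mul]
    linear_combination ⁅v i, a⁆ * removeNth_swap_aux α v X hi
  rw [Finset.sum_congr rfl e, Finset.sum_sub_distrib, ← Finset.mul_sum, update_self, update_self,
    Fin.removeNth_update, Fin.removeNth_update, smul_lieDeriv_fun,
    LieRinehartRing.lie_smul_eq_mul, ← Finset.mul_sum]
  have e2 : ∑ i, ⁅p.removeNth v i, a⁆ * α (update (p.removeNth v) i X) =
      ∑ i ∈ Finset.univ.erase p, ⁅v i, a⁆ * α (p.removeNth (update v i X)) := by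
    have h : Finset.univ.erase p = Finset.univ.image p.succAbove := by
      ext j
      simp
    rw [h, Finset.sum_image fun _ _ _ _ h => Fin.succAbove_right_injective h]
    exact Finset.sum_congr rfl fun j _ => by rw [Fin.removeNth_update_succAbove]; rfl
  rw [e2]
  ring

/-- The exterior derivative `dα`, given by the Koszul formula. -/
def extDeriv (α : Form A L k) : Form A L (k + 1) where
  toFun := koszul α
  map_update_add' := by
    intro _ v i x y
    obtain rfl : ‹DecidableEq (Fin (k + 1))› = instDecidableEqFin _ := Subsingleton.elim _ _
    apply two_mul_inj
    rw [mul_add, ← two_koszul, ← two_koszul, ← two_koszul, AlternatingMap.map_update_add]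
  map_update_smul' := by
    intro _ v i a x
    obtain rfl : ‹DecidableEq (Fin (k + 1))› = instDecidableEqFin _ := Subsingleton.elim _ _
    exact koszul_smul α a x v i
  map_eq_zero_of_eq' := by
    intro v i j hv hij
    apply two_mul_inj
    rw [← two_koszul, mul_zero]
    exact AlternatingMap.map_eq_zero_of_eq _ v hv hij

lemma koszul_add (α β : Form A L k) (v : Fin (k + 1) → L) :
    koszul (α + β) v = koszul α v + koszul β v := by
  simp only [koszul, AlternatingMap.add_apply, lie_add, mul_add, Finset.sum_add_distrib]
  abel

lemma koszul_real_smul (c : ℝ) (α : Form A L k) (v : Fin (k + 1) → L) :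
    koszul (c • α) v = c • koszul α v := by
  simp only [koszul, AlternatingMap.smul_apply, lie_smul, mul_smul_comm, smul_add,
    Finset.smul_sum]

/-- The wedge product: the sum over `(k, l)`-shuffles `s` of
`sign(s) α(v_{s(1)}, …, v_{s(k)}) β(v_{s(k+1)}, …, v_{s(k+l)})`. -/
def wedge {k l : ℕ} (α : Form A L k) (β : Form A L l) : Form A L (k + l) :=
  ((LinearMap.mul' A A).compAlternatingMap (α.domCoprod β)).domDomCongr finSumFinEquiv

section
variable {l : ℕ}

lemma add_wedge (α α' : Form A L k) (β : Form A L l) :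
    wedge (α + α') β = wedge α β + wedge α' β := by
  simp only [wedge, ← AlternatingMap.domCoprod'_apply, TensorProduct.add_tmul, map_add]
  ext v; simp

lemma wedge_add (α : Form A L k) (β β' : Form A L l) :
    wedge α (β + β') = wedge α β + wedge α β' := by
  simp only [wedge, ← AlternatingMap.domCoprod'_apply, TensorProduct.tmul_add, map_add]
  ext v; simp

lemma smul_eq_fun (c : ℝ) (α : Form A L k) : c • α = algebraMap ℝ A c • α := by
  ext v; simp [Algebra.smul_def]

lemma smul_wedge (c : ℝ) (α : Form A L k) (β : Form A L l) :
    wedge (c • α) β = c • wedge α β := by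
  simp only [wedge, smul_eq_fun, ← AlternatingMap.domCoprod'_apply, ← TensorProduct.smul_tmul',
    map_smul]
  ext v; simp

lemma wedge_smul (c : ℝ) (α : Form A L k) (β : Form A L l) :
    wedge α (c • β) = c • wedge α β := by
  simp only [wedge, smul_eq_fun, ← AlternatingMap.domCoprod'_apply, TensorProduct.tmul_smul,
    map_smul]
  ext v; simp

end

open DirectSum

variable (A L) in
/-- The exterior derivative on all forms. -/
def dTot : Forms A L →ₗ[ℝ] Forms A L :=
  DirectSum.toModule ℝ ℕ _ fun k => (DirectSum.lof ℝ ℕ (Form A L) (k + 1)).comp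
    ({ toFun := extDeriv
       map_add' := fun α β => AlternatingMap.ext (koszul_add α β)
       map_smul' := fun c α => AlternatingMap.ext (koszul_real_smul c α) } :
      Form A L k →ₗ[ℝ] Form A L (k + 1))

/-- The Lie derivative on all forms. -/
def lieTot (X : L) : Forms A L →ₗ[ℝ] Forms A L :=
  DirectSum.toModule ℝ ℕ _ fun k => (DirectSum.lof ℝ ℕ (Form A L) k).comp
    ({ toFun := lieDeriv X
       map_add' := lieDeriv_add X
       map_smul' := fun c α => lieDeriv_smul c X α } : Form A L k →ₗ[ℝ] Form A L k)

/-- The contraction on all forms. -/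
def contrTot (X : L) : Forms A L →ₗ[ℝ] Forms A L :=
  DirectSum.toModule ℝ ℕ _ fun k => (DirectSum.lof ℝ ℕ (Form A L) (k - 1)).comp
    ({ toFun := contr X k
       map_add' := map_add _
       map_smul' := fun c α => by
        rw [smul_eq_fun, map_smul, smul_eq_fun]; rfl } : Form A L k →ₗ[ℝ] Form A L (k - 1))

variable (A L) in
/-- The wedge product on all forms. -/
def wedgeTot : Forms A L →ₗ[ℝ] Forms A L →ₗ[ℝ] Forms A L :=
  DirectSum.toModule ℝ ℕ _ fun k => LinearMap.flip <| DirectSum.toModule ℝ ℕ _ fun l =>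
    LinearMap.mk₂ ℝ (fun (β : Form A L l) (α : Form A L k) =>
        DirectSum.lof ℝ ℕ (Form A L) (k + l) (wedge α β))
      (fun β β' α => by rw [wedge_add, map_add]) (fun c β α => by rw [wedge_smul, map_smul])
      (fun β α α' => by rw [add_wedge, map_add]) (fun c β α => by rw [smul_wedge, map_smul])

variable (A L) in
/-- The constant function `1`, a `0`-form. -/
def oneTot : Forms A L :=
  DirectSum.lof ℝ ℕ (Form A L) 0 (AlternatingMap.constOfIsEmpty A L (Fin 0) 1)

end
end LRForm

/-- A singular foliation of the `n`-manifold `M`: a partition of `M` (the classes of `leafRel`) into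
connected immersed submanifolds, the leaves, such that the module of smooth vector fields tangent to
the leaves is transitive on each leaf. The tangent space at `x` of the leaf of `x` is `tang x`; a
leaf is presented as the image of an injective immersion of a connected manifold. -/
structure SingularFoliation (n : ℕ) (M : Type u) [TopologicalSpace M]
    [ChartedSpace (EuclideanSpace ℝ (Fin n)) M] [IsManifold (𝓡 n) ∞ M] where
  leafRel : Setoid M
  tang : (x : M) → Submodule ℝ (TangentSpace (𝓡 n) x)
  leaf_immersed : ∀ x : M, ∃ (p : ℕ) (N : Type u) (_ : TopologicalSpace N)
    (_ : ChartedSpace (EuclideanSpace ℝ (Fin p)) N) (_ : IsManifold (𝓡 p) ∞ N) (i : N → M),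
    ConnectedSpace N ∧ SecondCountableTopology N ∧ ContMDiff (𝓡 p) (𝓡 n) ∞ i ∧
    Function.Injective i ∧ Set.range i = {y | leafRel x y} ∧
    ∀ z : N, Function.Injective (mfderiv (𝓡 p) (𝓡 n) i z) ∧
      LinearMap.range (mfderiv (𝓡 p) (𝓡 n) i z).toLinearMap = tang (i z)
  transitive : ∀ (x : M), ∀ v ∈ tang x, ∃ X : VField n M, (∀ y, X y ∈ tang y) ∧ X x = v

namespace SingularFoliation

section
variable {n : ℕ} {M : Type u} [TopologicalSpace M]
    [ChartedSpace (EuclideanSpace ℝ (Fin n)) M] [IsManifold (𝓡 n) ∞ M]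
  (F : SingularFoliation n M)

/-- `X` is a smooth field on `U` which is tangent to the leaves. -/
def TangentOn (U : Set M) (X : (x : M) → TangentSpace (𝓡 n) x) : Prop :=
  SmoothFieldOn U X ∧ ∀ x ∈ U, X x ∈ F.tang x

/-- `X` is a foliate field on `U`: it is smooth on `U`, and `[X, Y]` is tangent to the leaves
whenever `Y` is a smooth field on `U` tangent to the leaves. -/
def FoliateOn (U : Set M) (X : (x : M) → TangentSpace (𝓡 n) x) : Prop :=
  SmoothFieldOn U X ∧
    ∀ Y, F.TangentOn U Y → F.TangentOn U (VectorField.mlieBracket (𝓡 n) X Y)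

variable {F} {U V : Set M} {X Y Z : (x : M) → TangentSpace (𝓡 n) x}

lemma _root_.SmoothFieldOn.add (hX : SmoothFieldOn U X) (hY : SmoothFieldOn U Y) :
    SmoothFieldOn U (X + Y) := fun x hx =>
  ContMDiffWithinAt.add_section (V := fun x : M => TangentSpace (𝓡 n) x) (hX x hx) (hY x hx)

lemma _root_.SmoothFieldOn.smul (c : ℝ) (hX : SmoothFieldOn U X) :
    SmoothFieldOn U (c • X) := fun x hx =>
  ContMDiffWithinAt.const_smul_section (V := fun x : M => TangentSpace (𝓡 n) x) (hX x hx)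

lemma smooth_zero : SmoothFieldOn U (0 : (x : M) → TangentSpace (𝓡 n) x) := fun x _ =>
  (Bundle.contMDiff_zeroSection ℝ (fun x : M => TangentSpace (𝓡 n) x) x).contMDiffWithinAt

lemma TangentOn.mono (h : F.TangentOn U X) (hVU : V ⊆ U) : F.TangentOn V X :=
  ⟨ContMDiffOn.mono h.1 hVU, fun x hx => h.2 x (hVU hx)⟩

lemma TangentOn.congr (h : F.TangentOn U X) (hXY : ∀ x ∈ U, Y x = X x) : F.TangentOn U Y :=
  ⟨ContMDiffOn.congr h.1 fun x hx => by rw [hXY x hx], fun x hx => hXY x hx ▸ h.2 x hx⟩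

lemma TangentOn.add (hX : F.TangentOn U X) (hY : F.TangentOn U Y) : F.TangentOn U (X + Y) :=
  ⟨hX.1.add hY.1, fun x hx => add_mem (hX.2 x hx) (hY.2 x hx)⟩

lemma TangentOn.smul (c : ℝ) (hX : F.TangentOn U X) : F.TangentOn U (c • X) :=
  ⟨hX.1.smul c, fun x hx => Submodule.smul_mem _ c (hX.2 x hx)⟩

lemma tangentOn_zero : F.TangentOn U 0 := ⟨smooth_zero, fun _ _ => zero_mem _⟩

lemma mdiffAt (hU : IsOpen U) (hX : SmoothFieldOn U X) {x : M} (hx : x ∈ U) :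
    MDifferentiableAt (𝓡 n) (𝓡 n).tangent (fun x => (⟨x, X x⟩ : TangentBundle (𝓡 n) M)) x :=
  (hX.at hU hx).mdifferentiableAt (by simp)

lemma bracket_add_left (hU : IsOpen U) (hX : SmoothFieldOn U X) (hY : SmoothFieldOn U Y)
    {x : M} (hx : x ∈ U) : VectorField.mlieBracket (𝓡 n) (X + Y) Z x =
      VectorField.mlieBracket (𝓡 n) X Z x + VectorField.mlieBracket (𝓡 n) Y Z x :=
  VectorField.mlieBracket_add_left (mdiffAt hU hX hx) (mdiffAt hU hY hx)

lemma bracket_add_right (hU : IsOpen U) (hX : SmoothFieldOn U X) (hY : SmoothFieldOn U Y)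
    {x : M} (hx : x ∈ U) : VectorField.mlieBracket (𝓡 n) Z (X + Y) x =
      VectorField.mlieBracket (𝓡 n) Z X x + VectorField.mlieBracket (𝓡 n) Z Y x :=
  VectorField.mlieBracket_add_right (mdiffAt hU hX hx) (mdiffAt hU hY hx)

lemma bracket_smul_left (hU : IsOpen U) (c : ℝ) (hX : SmoothFieldOn U X)
    {x : M} (hx : x ∈ U) : VectorField.mlieBracket (𝓡 n) (c • X) Z x =
      c • VectorField.mlieBracket (𝓡 n) X Z x :=
  VectorField.mlieBracket_const_smul_left (mdiffAt hU hX hx)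

lemma bracket_smul_right (hU : IsOpen U) (c : ℝ) (hX : SmoothFieldOn U X)
    {x : M} (hx : x ∈ U) : VectorField.mlieBracket (𝓡 n) Z (c • X) x =
      c • VectorField.mlieBracket (𝓡 n) Z X x :=
  VectorField.mlieBracket_const_smul_right (mdiffAt hU hX hx)

lemma bracket_swap (X Y : (x : M) → TangentSpace (𝓡 n) x) (x : M) :
    VectorField.mlieBracket (𝓡 n) X Y x = - VectorField.mlieBracket (𝓡 n) Y X x :=
  VectorField.mlieBracket_swap_apply

lemma FoliateOn.add (hU : IsOpen U) (hX : F.FoliateOn U X) (hY : F.FoliateOn U Y) :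
    F.FoliateOn U (X + Y) :=
  ⟨hX.1.add hY.1, fun Z hZ => ((hX.2 Z hZ).add (hY.2 Z hZ)).congr fun _ hx =>
    bracket_add_left hU hX.1 hY.1 hx⟩

lemma FoliateOn.smul (hU : IsOpen U) (c : ℝ) (hX : F.FoliateOn U X) : F.FoliateOn U (c • X) :=
  ⟨hX.1.smul c, fun Z hZ => ((hX.2 Z hZ).smul c).congr fun _ hx =>
    bracket_smul_left hU c hX.1 hx⟩

lemma foliateOn_zero : F.FoliateOn U 0 :=
  ⟨smooth_zero, fun Z _ => (tangentOn_zero (F := F)).congr fun x _ => by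
    rw [VectorField.mlieBracket_zero_left]⟩

lemma FoliateOn.bracket (hU : IsOpen U) (hX : F.FoliateOn U X) (hY : F.FoliateOn U Y) :
    F.FoliateOn U (VectorField.mlieBracket (𝓡 n) X Y) :=
  ⟨hX.1.bracket hU hY.1, fun Z hZ =>
    ((hX.2 _ (hY.2 Z hZ)).add ((hY.2 _ (hX.2 Z hZ)).smul (-1))).congr fun x hx => by
      have := bracket_jacobi (hX.1.at hU hx) (hY.1.at hU hx) (hZ.1.at hU hx)
      rw [Pi.add_apply, Pi.smul_apply, this]
      module⟩

lemma FoliateOn.mono [T2Space M] (hV : IsOpen V) (h : F.FoliateOn U X)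
    (hVU : V ⊆ U) : F.FoliateOn V X := by
  refine ⟨ContMDiffOn.mono h.1 hVU, fun Y hY => ⟨?_, fun x hx => ?_⟩⟩
  · exact SmoothFieldOn.bracket hV (ContMDiffOn.mono h.1 hVU) hY.1
  · obtain ⟨ρ, h1, h2⟩ := exists_cutoff (n := n) hV hx
    obtain ⟨W, hW⟩ : ∃ W : (x : M) → TangentSpace (𝓡 n) x, W = fun y => ρ y • Y y := ⟨_, rfl⟩
    have hW' : ∀ y, W y = ρ y • Y y := fun y => by rw [hW]
    have hT : F.TangentOn U W := by
      refine ⟨hW ▸ hY.1.cutoff hV ρ h2, fun y _ => ?_⟩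
      rw [hW' y]
      by_cases hy : y ∈ V
      · exact Submodule.smul_mem _ _ (hY.2 y hy)
      · have : ρ y = 0 := by
          by_contra h0
          exact hy (h2 (subset_tsupport _ h0))
        rw [this, zero_smul]; exact zero_mem _
    have := (h.2 _ hT).2 x (hVU hx)
    have e : W =ᶠ[𝓝 x] Y := h1.mono fun y hy => by rw [hW', hy, one_smul]
    have e2 : VectorField.mlieBracket (𝓡 n) X W x = VectorField.mlieBracket (𝓡 n) X Y x :=
      EventuallyEq.mlieBracket_vectorField_eq EventuallyEq.rfl e
    rwa [e2] at this

end

section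
variable {n : ℕ} {M : Type u} [TopologicalSpace M]
    [ChartedSpace (EuclideanSpace ℝ (Fin n)) M] [IsManifold (𝓡 n) ∞ M] [T2Space M]
  (F : SingularFoliation n M)

/-- The fields which are foliate on some open set that belongs to the filter `f`. Here `f = ⊤` gives
the global foliate fields `𝔏(F)`, `f = 𝓟 U` gives those on an open set `U`, and `f = 𝓝 x` gives
representatives of the germs of foliate fields at `x`. -/
def foliateFields (f : Filter M) : Submodule ℝ ((x : M) → TangentSpace (𝓡 n) x) where
  carrier := {X | ∃ U ∈ f, IsOpen U ∧ F.FoliateOn U X}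
  add_mem' := by
    rintro X Y ⟨U, hU, hU', hX⟩ ⟨V, hV, hV', hY⟩
    have ho := hU'.inter hV'
    exact ⟨U ∩ V, inter_mem hU hV, ho,
      (hX.mono ho inter_subset_left).add ho (hY.mono ho inter_subset_right)⟩
  zero_mem' := ⟨univ, univ_mem, isOpen_univ, foliateOn_zero⟩
  smul_mem' := by
    rintro c X ⟨U, hU, hU', hX⟩
    exact ⟨U, hU, hU', hX.smul hU' c⟩

/-- The elements of `F.foliateFields f` that are tangent to the leaves on some open set in `f`.
For `f = ⊤` this is `𝔛(F)` (which is contained in `𝔏(F)`, as it is closed under brackets). -/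
def tangentFields (f : Filter M) : Submodule ℝ (F.foliateFields f) where
  carrier := {X | ∃ U ∈ f, IsOpen U ∧ F.TangentOn U X}
  add_mem' := by
    rintro X Y ⟨U, hU, hU', hX⟩ ⟨V, hV, hV', hY⟩
    exact ⟨U ∩ V, inter_mem hU hV, hU'.inter hV',
      (hX.mono inter_subset_left).add (hY.mono inter_subset_right)⟩
  zero_mem' := ⟨univ, univ_mem, isOpen_univ, tangentOn_zero⟩
  smul_mem' := by
    rintro c X ⟨U, hU, hU', hX⟩
    exact ⟨U, hU, hU', hX.smul c⟩

/-- The transverse fields: for `f = ⊤` the global ones `𝔩(F) = 𝔏(F) / 𝔛(F)`, for `f = 𝓝 x` the germs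
at `x` of transverse fields. -/
def TransverseFields (f : Filter M) : Type u := F.foliateFields f ⧸ F.tangentFields f

namespace TransverseFields
variable {F} {f g : Filter M}

instance : AddCommGroup (F.TransverseFields f) :=
  inferInstanceAs (AddCommGroup (F.foliateFields f ⧸ F.tangentFields f))

instance : Module ℝ (F.TransverseFields f) :=
  inferInstanceAs (Module ℝ (F.foliateFields f ⧸ F.tangentFields f))

variable (F f) in
/-- The class of a foliate field. -/
def mk : F.foliateFields f →ₗ[ℝ] F.TransverseFields f := (F.tangentFields f).mkQ

/-- The bracket of foliate fields. -/
def bracket (X Y : F.foliateFields f) : F.foliateFields f :=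
  ⟨VectorField.mlieBracket (𝓡 n) X Y, by
    obtain ⟨U, hU, hU', hX⟩ := X.2
    obtain ⟨V, hV, hV', hY⟩ := Y.2
    have ho := hU'.inter hV'
    exact ⟨U ∩ V, inter_mem hU hV, ho,
      (hX.mono ho inter_subset_left).bracket ho (hY.mono ho inter_subset_right)⟩⟩

lemma mk_eq {X Y : F.foliateFields f} :
    mk F f X = mk F f Y ↔ ∃ U ∈ f, IsOpen U ∧
      F.TangentOn U ((X : (x : M) → TangentSpace (𝓡 n) x) - Y) :=
  Submodule.Quotient.eq _

lemma mk_eq_of_eqOn {X Y : F.foliateFields f} {U : Set M} (hU : U ∈ f) (hU' : IsOpen U)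
    (h : ∀ x ∈ U, (X : (x : M) → TangentSpace (𝓡 n) x) x = Y.1 x) : mk F f X = mk F f Y :=
  mk_eq.2 ⟨U, hU, hU', tangentOn_zero.congr fun x hx => by simp [h x hx]⟩

lemma mk_bracket_add_left (X X' Y : F.foliateFields f) :
    mk F f (bracket (X + X') Y) = mk F f (bracket X Y) + mk F f (bracket X' Y) := by
  obtain ⟨U, hU, hU', hX⟩ := X.2
  obtain ⟨V, hV, hV', hX'⟩ := X'.2
  rw [← map_add]
  refine mk_eq_of_eqOn (inter_mem hU hV) (hU'.inter hV') fun x hx => ?_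
  exact bracket_add_left (hU'.inter hV') (ContMDiffOn.mono hX.1 inter_subset_left)
    (ContMDiffOn.mono hX'.1 inter_subset_right) hx

lemma mk_bracket_swap (X Y : F.foliateFields f) :
    mk F f (bracket X Y) = - mk F f (bracket Y X) := by
  rw [← map_neg]
  exact mk_eq_of_eqOn univ_mem isOpen_univ fun x _ => bracket_swap X.1 Y.1 x

lemma mk_bracket_smul_left (c : ℝ) (X Y : F.foliateFields f) :
    mk F f (bracket (c • X) Y) = c • mk F f (bracket X Y) := by
  obtain ⟨U, hU, hU', hX⟩ := X.2
  rw [← map_smul]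
  exact mk_eq_of_eqOn hU hU' fun x hx => bracket_smul_left hU' c hX.1 hx

lemma mk_bracket_tangent (X : F.foliateFields f) {Y : F.foliateFields f}
    (h : Y ∈ F.tangentFields f) : mk F f (bracket X Y) = 0 := by
  obtain ⟨U, hU, hU', hX⟩ := X.2
  obtain ⟨V, hV, hV', hY⟩ := h
  rw [← map_zero (mk F f)]
  refine mk_eq.2 ⟨U ∩ V, inter_mem hU hV, hU'.inter hV', ?_⟩
  refine ((hX.mono (hU'.inter hV') inter_subset_left).2 _ (hY.mono inter_subset_right)).congr
    fun x _ => ?_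
  simp [bracket]

/-- The bracket of transverse fields, induced by the bracket of foliate representatives. -/
def bracketₗ : F.TransverseFields f →ₗ[ℝ] F.TransverseFields f →ₗ[ℝ] F.TransverseFields f :=
  Submodule.liftQ (F.tangentFields f)
    { toFun := fun X => Submodule.liftQ (F.tangentFields f)
        { toFun := fun Y => mk F f (bracket X Y)
          map_add' := fun Y Y' => by
            rw [mk_bracket_swap, mk_bracket_add_left, mk_bracket_swap X, mk_bracket_swap X]; abel
          map_smul' := fun c Y => by
            rw [mk_bracket_swap, mk_bracket_smul_left, mk_bracket_swap X]; simp }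
        (fun Y hY => mk_bracket_tangent X hY)
      map_add' := fun X X' => Submodule.linearMap_qext _ (LinearMap.ext fun Y =>
        mk_bracket_add_left X X' Y)
      map_smul' := fun c X => Submodule.linearMap_qext _ (LinearMap.ext fun Y =>
        mk_bracket_smul_left c X Y) }
    (fun X hX => Submodule.linearMap_qext _ (LinearMap.ext fun Y =>
      (mk_bracket_swap X Y).trans (by rw [mk_bracket_tangent Y hX, neg_zero]; rfl)))

instance : Bracket (F.TransverseFields f) (F.TransverseFields f) := ⟨fun a b => bracketₗ a b⟩

lemma mk_lie (X Y : F.foliateFields f) : ⁅mk F f X, mk F f Y⁆ = mk F f (bracket X Y) := rfl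

lemma mk_surjective : Function.Surjective (mk F f) := Submodule.mkQ_surjective _

instance : LieRing (F.TransverseFields f) where
  add_lie a b c := by
    change bracketₗ (a + b) c = bracketₗ a c + bracketₗ b c
    rw [map_add]; rfl
  lie_add a b c := map_add (bracketₗ a) b c
  lie_self a := by
    obtain ⟨X, rfl⟩ := mk_surjective a
    rw [mk_lie]
    have h := mk_bracket_swap X X
    have h2 : (2 : ℝ) • mk F f (bracket X X) = 0 := by
      rw [two_smul]; nth_rw 1 [h]; exact neg_add_cancel _
    exact (smul_eq_zero.1 h2).resolve_left two_ne_zero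
  leibniz_lie a b c := by
    obtain ⟨X, rfl⟩ := mk_surjective a
    obtain ⟨Y, rfl⟩ := mk_surjective b
    obtain ⟨Z, rfl⟩ := mk_surjective c
    obtain ⟨U, hU, hU', hX⟩ := X.2
    obtain ⟨V, hV, hV', hY⟩ := Y.2
    obtain ⟨W, hW, hW', hZ⟩ := Z.2
    simp only [mk_lie]
    rw [← map_add]
    refine mk_eq_of_eqOn (inter_mem (inter_mem hU hV) hW) ((hU'.inter hV').inter hW')
      fun x hx => ?_
    exact bracket_jacobi (hX.1.at hU' hx.1.1) (hY.1.at hV' hx.1.2) (hZ.1.at hW' hx.2)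

instance : LieAlgebra ℝ (F.TransverseFields f) where
  lie_smul c a b := map_smul (bracketₗ a) c b

lemma foliateFields_mono (h : g ≤ f) : F.foliateFields f ≤ F.foliateFields g :=
  fun _ ⟨U, hU, h'⟩ => ⟨U, h hU, h'⟩

/-- Restriction of transverse fields. For `g = 𝓝 x` and `f = ⊤` this is the map that takes a global
transverse field to its germ at `x`. -/
def restrict (h : g ≤ f) : F.TransverseFields f →ₗ⁅ℝ⁆ F.TransverseFields g where
  toLinearMap := Submodule.mapQ (F.tangentFields f) (F.tangentFields g)
    (Submodule.inclusion (foliateFields_mono h)) (fun _ ⟨U, hU, h'⟩ => ⟨U, h hU, h'⟩)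
  map_lie' := by
    intro a b
    obtain ⟨X, rfl⟩ := mk_surjective a
    obtain ⟨Y, rfl⟩ := mk_surjective b
    rfl

end TransverseFields
end
end SingularFoliation

namespace SingularFoliation

section
variable {n : ℕ} {M : Type u} [TopologicalSpace M]
    [ChartedSpace (EuclideanSpace ℝ (Fin n)) M] [IsManifold (𝓡 n) ∞ M]
  (F : SingularFoliation n M)

/-- The dimension of `F`: the maximal dimension of its leaves. -/
def dim : ℕ := ⨆ x, Module.finrank ℝ (F.tang x)

/-- The regular stratum: the union of the leaves of maximal dimension. -/
def reg : Set M := {x | Module.finrank ℝ (F.tang x) = F.dim}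

/-- The velocity of the curve `γ` at time `t`. -/
def _root_.velocity (γ : ℝ → M) (t : ℝ) : TangentSpace (𝓡 n) (γ t) :=
  mfderiv 𝓘(ℝ, ℝ) (𝓡 n) γ t (1 : ℝ)

/-- The tangent vectors at `x` of the stratum of `x`, the union of all leaves of the same dimension as
the leaf of `x`: the velocities of smooth curves in that stratum. -/
def stratumTangent (x : M) : Set (TangentSpace (𝓡 n) x) :=
  {v | ∃ γ : ℝ → M, ContMDiff 𝓘(ℝ, ℝ) (𝓡 n) ∞ γ ∧ γ 0 = x ∧
    (∀ t, Module.finrank ℝ (F.tang (γ t)) = Module.finrank ℝ (F.tang x)) ∧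
    HasMFDerivAt 𝓘(ℝ, ℝ) (𝓡 n) γ 0 ((1 : ℝ →L[ℝ] ℝ).smulRight v)}

/-- The model space `ℝ^q`, `q = codim F`, of the transverse manifolds. -/
abbrev TransModel (F : SingularFoliation n M) : Type := EuclideanSpace ℝ (Fin (n - F.dim))

/-- A submersion with connected fibers, from an open subset of (necessarily) the regular stratum to
`ℝ^q`, that defines `F` there: the kernels of its differentials are the tangent spaces of the
leaves. All of them together form the (maximal) cocycle of the regular foliation `F_reg`. -/
structure LocalSubmersion where
  source : Set M
  isOpen_source : IsOpen source
  toFun : M → F.TransModel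
  smooth : ContMDiffOn (𝓡 n) 𝓘(ℝ, F.TransModel) ∞ toFun source
  surjective : ∀ x ∈ source,
    Function.Surjective (mfderiv (𝓡 n) 𝓘(ℝ, F.TransModel) toFun x)
  ker_eq : ∀ x ∈ source,
    LinearMap.ker (mfderiv (𝓡 n) 𝓘(ℝ, F.TransModel) toFun x).toLinearMap = F.tang x
  fiber_connected : ∀ y, IsPreconnected (source ∩ toFun ⁻¹' {y})

variable {F}

/-- The image of the submersion: the local transverse manifold. -/
def LocalSubmersion.target (σ : F.LocalSubmersion) : Set F.TransModel := σ.toFun '' σ.source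

/-- `HolonomyGerm σ σ' y h`: the germ at `y` of `h`, from the image of `σ` to the image of `σ'`, is a
composition of germs of transition maps of the cocycle. The transition maps satisfy `h ∘ σ = σ'`. -/
inductive HolonomyGerm : F.LocalSubmersion → F.LocalSubmersion → F.TransModel →
    (F.TransModel → F.TransModel) → Prop
  | transition (σ σ' : F.LocalSubmersion) (x : M) (hx : x ∈ σ.source) (hx' : x ∈ σ'.source)
      (h : F.TransModel → F.TransModel) (hh : ∀ᶠ z in 𝓝 x, h (σ.toFun z) = σ'.toFun z) :
      HolonomyGerm σ σ' (σ.toFun x) h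
  | comp {σ σ' σ'' : F.LocalSubmersion} {y : F.TransModel} {h k : F.TransModel → F.TransModel} :
      HolonomyGerm σ σ' y h → HolonomyGerm σ' σ'' (h y) k → HolonomyGerm σ σ'' y (k ∘ h)
  | congr {σ σ' : F.LocalSubmersion} {y : F.TransModel} {h k : F.TransModel → F.TransModel} :
      HolonomyGerm σ σ' y h → h =ᶠ[𝓝 y] k → HolonomyGerm σ σ' y k

/-- `h : V → h(V)` is an element of the holonomy pseudogroup of `F_reg` that goes from the image of `σ`
to the image of `σ'`: a local diffeomorphism all of whose germs are compositions of germs of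
transition maps. -/
def IsHolonomy (σ σ' : F.LocalSubmersion) (V : Set F.TransModel)
    (h : F.TransModel → F.TransModel) : Prop :=
  IsOpen V ∧ V ⊆ σ.target ∧ InjOn h V ∧ ∀ y ∈ V, HolonomyGerm σ σ' y h

/-- `h : V → h(V)` is an element of the closure of the holonomy pseudogroup: a local diffeomorphism
that is locally a `C¹`-limit of elements of the holonomy pseudogroup. -/
def IsClosureHolonomy (σ σ' : F.LocalSubmersion) (V : Set F.TransModel)
    (h : F.TransModel → F.TransModel) : Prop :=
  IsOpen V ∧ V ⊆ σ.target ∧ MapsTo h V σ'.target ∧ InjOn h V ∧ ContDiffOn ℝ ∞ h V ∧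
  (∀ y ∈ V, Function.Bijective (fderiv ℝ h y)) ∧
  ∀ y ∈ V, ∃ W ⊆ V, IsOpen W ∧ y ∈ W ∧ ∃ H : ℕ → F.TransModel → F.TransModel,
    (∀ k, IsHolonomy σ σ' W (H k)) ∧ TendstoLocallyUniformlyOn H h atTop W ∧
    TendstoLocallyUniformlyOn (fun k => fderiv ℝ (H k)) (fderiv ℝ h) atTop W

/-- The smooth field `Y` on the open set `W` of the image of `σ` belongs to the Lie algebra sheaf of the
closure of the holonomy pseudogroup: its local flows consist of elements of that closure. -/
def IsInfinitesimal (σ : F.LocalSubmersion) (W : Set F.TransModel)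
    (Y : F.TransModel → F.TransModel) : Prop :=
  IsOpen W ∧ W ⊆ σ.target ∧ ContDiffOn ℝ ∞ Y W ∧
  ∀ y ∈ W, ∃ V ⊆ W, IsOpen V ∧ y ∈ V ∧ ∃ ε > (0 : ℝ), ∃ Φ : ℝ → F.TransModel → F.TransModel,
    (∀ z ∈ V, Φ 0 z = z ∧ ∀ t ∈ Ioo (-ε) ε,
      Φ t z ∈ W ∧ HasDerivAt (fun s => Φ s z) (Y (Φ t z)) t) ∧
    ∀ t ∈ Ioo (-ε) ε, IsClosureHolonomy σ σ V (Φ t)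

variable (F)

/-- For `U` contained in the regular stratum: the transverse field represented by `X` is a section over
`U` of the Molino sheaf `C_reg` of `F_reg`. Locally, `X` is projectable by a submersion defining `F`
to a field whose flow lies in the closure of the holonomy pseudogroup. -/
def IsMolinoOn (U : Set M) (X : (x : M) → TangentSpace (𝓡 n) x) : Prop :=
  ∀ x ∈ U, ∃ (σ : F.LocalSubmersion) (V : Set M), IsOpen V ∧ x ∈ V ∧ V ⊆ U ∩ σ.source ∧
    ∃ Y : F.TransModel → F.TransModel, IsInfinitesimal σ (σ.toFun '' V) Y ∧
      ∀ z ∈ V, mfderiv (𝓡 n) 𝓘(ℝ, F.TransModel) σ.toFun z (X z) = Y (σ.toFun z)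

/-- The sections of the Molino sheaf `C_F` which are transverse fields: the classes of foliate fields
that restrict to sections of `C_reg` on the regular stratum. For `f = ⊤` this is `C_F(M)`, and for
`f = 𝓝 x` it is the stalk of `C_F` at `x`. -/
def molinoSections [T2Space M] (f : Filter M) : Set (F.TransverseFields f) :=
  {s | ∃ X : F.foliateFields f, TransverseFields.mk F f X = s ∧
    ∃ U ∈ f, IsOpen U ∧ F.FoliateOn U X ∧ F.IsMolinoOn (U ∩ F.reg) X}

/-- `𝔞` is (isomorphic to) the structural algebra of `F`: the opposite Lie algebra of the stalk of
`C_reg` at a regular point. -/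
def IsStructuralAlgebra [T2Space M] (𝔞 : Type*) [LieRing 𝔞] [LieAlgebra ℝ 𝔞] : Prop :=
  ∃ x ∈ F.reg, ∃ j : 𝔞 →ₗ[ℝ] F.TransverseFields (𝓝 x), Function.Injective j ∧
    Set.range j = F.molinoSections (𝓝 x) ∧ ∀ a b, j ⁅a, b⁆ = ⁅j b, j a⁆

end

section Riemannian
variable {n : ℕ} {M : Type u} [MetricSpace M]
    [ChartedSpace (EuclideanSpace ℝ (Fin n)) M] [IsManifold (𝓡 n) ∞ M]


/-- `γ` is a geodesic on the interval `(a, b)`: a smooth curve that locally realizes the distance, with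
constant speed `c`. -/
def _root_.IsGeodesicOn (a b : ℝ) (γ : ℝ → M) : Prop :=
  ContMDiffOn 𝓘(ℝ, ℝ) (𝓡 n) ∞ γ (Ioo a b) ∧
  ∃ c ≥ (0 : ℝ), ∀ t ∈ Ioo a b, ∃ δ > (0 : ℝ), Ioo (t - δ) (t + δ) ⊆ Ioo a b ∧
    ∀ s ∈ Ioo (t - δ) (t + δ), ∀ s' ∈ Ioo (t - δ) (t + δ), dist (γ s) (γ s') = c * |s - s'|

variable [RiemannianBundle (fun x : M => TangentSpace (𝓡 n) x)] (F : SingularFoliation n M)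

/-- The metric is adapted to `F`: every geodesic that is perpendicular to a leaf is perpendicular to
all the leaves it meets. -/
def IsSingularRiemannian : Prop :=
  ∀ (a b : ℝ) (γ : ℝ → M), IsGeodesicOn (n := n) a b γ →
    (∃ t ∈ Ioo a b, ∀ w ∈ F.tang (γ t), inner ℝ (velocity (n := n) γ t) w = 0) →
    ∀ t ∈ Ioo a b, ∀ w ∈ F.tang (γ t), inner ℝ (velocity (n := n) γ t) w = 0

instance (x : M) : FiniteDimensional ℝ (TangentSpace (𝓡 n) x) :=
  inferInstanceAs (FiniteDimensional ℝ (EuclideanSpace ℝ (Fin n)))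

/-- The transverse metric: the inner product of the components perpendicular to the leaves. -/
def transverseMetric (x : M) (v w : TangentSpace (𝓡 n) x) : ℝ :=
  inner ℝ ((F.tang x)ᗮ.starProjection v) ((F.tang x)ᗮ.starProjection w)

/-- `φ` is a smooth local flow of `X` in `U`, defined on `V` for times in `(-ε, ε)`. -/
def _root_.IsLocalFlow (X : (x : M) → TangentSpace (𝓡 n) x) (U V : Set M) (ε : ℝ)
    (φ : ℝ → M → M) : Prop :=
  ContMDiffOn (𝓘(ℝ, ℝ).prod (𝓡 n)) (𝓡 n) ∞ (fun p : ℝ × M => φ p.1 p.2) (Ioo (-ε) ε ×ˢ V) ∧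
  ∀ x ∈ V, φ 0 x = x ∧ (∀ t ∈ Ioo (-ε) ε, φ t x ∈ U) ∧
    IsMIntegralCurveOn (fun t => φ t x) X (Ioo (-ε) ε)

/-- The foliate field `X` on `U` represents a transverse Killing vector field: its local flows preserve
the transverse metric of each stratum. -/
def KillingOn (U : Set M) (X : (x : M) → TangentSpace (𝓡 n) x) : Prop :=
  F.FoliateOn U X ∧
  ∀ (V : Set M) (ε : ℝ) (φ : ℝ → M → M), IsOpen V → V ⊆ U → IsLocalFlow X U V ε φ →
    ∀ t ∈ Ioo (-ε) ε, ∀ x ∈ V, ∀ v ∈ F.stratumTangent x, ∀ w ∈ F.stratumTangent x,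
      F.transverseMetric (φ t x) (mfderiv (𝓡 n) (𝓡 n) (φ t) x v)
        (mfderiv (𝓡 n) (𝓡 n) (φ t) x w) = F.transverseMetric x v w

/-- For a complete Riemannian manifold `M`, with the given metric as the adapted metric: `F` is a
singular Killing foliation.
* `riemannian`: `F` is a singular Riemannian foliation;
* `killing`: `C_F` is a sheaf of germs of transverse Killing vector fields, that is, each section
  of `C_reg` over the regular part of an open set `U` extends, near each point of `U`, to a (smooth)
  transverse Killing vector field;
* `constant`: `C_F` is a globally constant sheaf of Lie algebras, that is, there is a Lie algebra
  of global sections which is mapped bijectively to each stalk. -/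
structure IsSingularKilling : Prop where
  riemannian : F.IsSingularRiemannian
  killing : ∀ (U : Set M) (X : (x : M) → TangentSpace (𝓡 n) x), IsOpen U →
    F.FoliateOn (U ∩ F.reg) X → F.IsMolinoOn (U ∩ F.reg) X →
    ∀ x ∈ U, ∃ V ⊆ U, IsOpen V ∧ x ∈ V ∧ ∃ X' : (x : M) → TangentSpace (𝓡 n) x,
      F.KillingOn V X' ∧ F.TangentOn (V ∩ F.reg) (X - X')
  constant : ∃ Z : LieSubalgebra ℝ (F.TransverseFields ⊤),
    (Z : Set (F.TransverseFields ⊤)) ⊆ F.molinoSections ⊤ ∧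
    ∀ x : M, BijOn (TransverseFields.restrict (le_top : 𝓝 x ≤ ⊤)) Z (F.molinoSections (𝓝 x))

end Riemannian

section Basic
open DirectSum LRForm
variable {n : ℕ} {M : Type u} [TopologicalSpace M]
    [ChartedSpace (EuclideanSpace ℝ (Fin n)) M] [IsManifold (𝓡 n) ∞ M] [T2Space M]
  (F : SingularFoliation n M)

/-- The space `Ω(F)` of basic forms: `ι_X ω = 0` and `L_X ω = 0` for all vector fields `X` tangent to the
leaves. -/
def basicForms : Submodule ℝ (Forms (SmoothFun n M) (VField n M)) where
  carrier := {w | ∀ X : VField n M, (∀ x, X x ∈ F.tang x) →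
    contrTot X w = 0 ∧ lieTot X w = 0}
  add_mem' h h' X hX := by
    rw [map_add, map_add, (h X hX).1, (h' X hX).1, (h X hX).2, (h' X hX).2]; simp
  zero_mem' X hX := by simp
  smul_mem' c _ h X hX := by
    rw [map_smul, map_smul, (h X hX).1, (h X hX).2]; simp

/-- The basic forms of degree `i`. -/
def basicGrading (i : ℤ) : Submodule ℝ F.basicForms where
  carrier := {w | ∀ k : ℕ, (k : ℤ) ≠ i → (w : Forms (SmoothFun n M) (VField n M)) k = 0}
  add_mem' h h' k hk := by
    change (_ + _ : Forms (SmoothFun n M) (VField n M)) k = 0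
    rw [DirectSum.add_apply, h k hk, h' k hk, add_zero]
  zero_mem' k hk := rfl
  smul_mem' c a h k hk := by
    change (c • (a : Forms (SmoothFun n M) (VField n M))) k = 0
    rw [DirectSum.smul_apply, h k hk, smul_zero]

/-- The foliate vector field `X` on `M` represents the transverse field `s`. -/
def Represents (X : VField n M) (s : F.TransverseFields ⊤) : Prop :=
  ∃ h : (X : (x : M) → TangentSpace (𝓡 n) x) ∈ F.foliateFields ⊤,
    TransverseFields.mk F ⊤ ⟨X, h⟩ = s

end Basic
end SingularFoliation

/-- A `𝔤⋆`-algebra structure on the real vector space `B` with `ℤ`-grading `𝒜`: a graded-commutative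
differential graded algebra with derivations `lie X` of degree `0` and `contr X` of degree `-1`, linear
in `X : 𝔤`, such that `ι_X² = 0`, `[L_X, L_Y] = L_[X,Y]`, `[L_X, ι_Y] = ι_[X,Y]` and
`L_X = d ι_X + ι_X d`. -/
structure GStarAlgebra (𝔤 : Type*) [LieRing 𝔤] [LieAlgebra ℝ 𝔤] (B : Type*) [AddCommMonoid B]
    [Module ℝ B] (𝒜 : ℤ → Submodule ℝ B) where
  mul : B →ₗ[ℝ] B →ₗ[ℝ] B
  one : B
  d : B →ₗ[ℝ] B
  lie : 𝔤 →ₗ[ℝ] B →ₗ[ℝ] B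
  contr : 𝔤 →ₗ[ℝ] B →ₗ[ℝ] B
  isInternal : DirectSum.IsInternal 𝒜
  one_mem : one ∈ 𝒜 0
  mul_mem : ∀ {i j : ℤ} {a b : B}, a ∈ 𝒜 i → b ∈ 𝒜 j → mul a b ∈ 𝒜 (i + j)
  one_mul : ∀ a, mul one a = a
  mul_one : ∀ a, mul a one = a
  mul_assoc : ∀ a b c, mul (mul a b) c = mul a (mul b c)
  mul_comm : ∀ {i j : ℤ} {a b : B}, a ∈ 𝒜 i → b ∈ 𝒜 j →
    mul a b = ((i * j).negOnePow : ℝ) • mul b a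
  d_mem : ∀ {i : ℤ} {a : B}, a ∈ 𝒜 i → d a ∈ 𝒜 (i + 1)
  d_d : ∀ a, d (d a) = 0
  d_mul : ∀ {i : ℤ} {a : B}, a ∈ 𝒜 i → ∀ b, d (mul a b) = mul (d a) b + (i.negOnePow : ℝ) • mul a (d b)
  lie_mem : ∀ (X : 𝔤) {i : ℤ} {a : B}, a ∈ 𝒜 i → lie X a ∈ 𝒜 i
  lie_mul : ∀ (X : 𝔤) (a b : B), lie X (mul a b) = mul (lie X a) b + mul a (lie X b)
  contr_mem : ∀ (X : 𝔤) {i : ℤ} {a : B}, a ∈ 𝒜 i → contr X a ∈ 𝒜 (i - 1)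
  contr_mul : ∀ (X : 𝔤) {i : ℤ} {a : B}, a ∈ 𝒜 i → ∀ b,
    contr X (mul a b) = mul (contr X a) b + (i.negOnePow : ℝ) • mul a (contr X b)
  contr_contr : ∀ (X : 𝔤) (a : B), contr X (contr X a) = 0
  lie_lie : ∀ (X Y : 𝔤) (a : B), lie X (lie Y a) = lie ⁅X, Y⁆ a + lie Y (lie X a)
  lie_contr : ∀ (X Y : 𝔤) (a : B), lie X (contr Y a) = contr ⁅X, Y⁆ a + contr Y (lie X a)
  cartan : ∀ (X : 𝔤) (a : B), lie X a = d (contr X a) + contr X (d a)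

end

/-!
The two parts of the statement are independent of each other.

*The transverse action.* Some Lie algebra `Z` of global sections of the Molino sheaf is mapped
bijectively onto every stalk. Given a global section `s`, the points at which `s` has the same germ as
a fixed element of `Z` form an open set, and so do the points at which it does not, as two elements of
`Z` with a common germ are equal. As `M` is connected, `Z` consists of all global sections
(`mem_of_bijOn_stalks`). Extending germs at a regular point to elements of `Z` gives a bijection from
the structural algebra to the global sections which reverses brackets; its negative is the required
homomorphism (`exists_transverse_action`).

*The `𝔤⋆`-algebra of basic forms.* The identities of a `𝔤⋆`-algebra hold on all forms, for any
Lie-Rinehart algebra over the reals. Three of them are verified on vectors: contraction is an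
antiderivation of the wedge product (`contrTot_wedge_lof`), `[L_X, ι_Y] = ι_[X,Y]` (`lieTot_contrTot`)
and Cartan's formula (`lieTot_eq`). All others follow from these by induction on the degree, because a
form is determined by its function part and its contractions (`Forms.family_eq_zero`). The
commutation relations show that the basic forms are stable under all the operations, if the vector
fields are foliate, and by definition tangent fields act trivially on them. Hence the operators of a
transverse field can be computed with any foliate representative, and they inherit all identities
(`basicGStarAlgebra`).
-/

noncomputable section

namespace LRForm
open Function Equiv

/-! ### Alternating sums and the wedge product -/

section AltSum
variable {L A : Type*} [AddCommGroup A] {m : ℕ}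

/-- The alternating sum `∑ σ, sign σ • T (v ∘ σ)` of a function `T` of `N` vectors; no linearity of
`T` is required. -/
def altSum {N : ℕ} (T : (Fin N → L) → A) (v : Fin N → L) : A :=
  ∑ σ : Perm (Fin N), (Perm.sign σ : ℤ) • T (v ∘ σ)

lemma altSum_smul {N : ℕ} (c : ℤ) (T : (Fin N → L) → A) (v : Fin N → L) :
    altSum (fun w => c • T w) v = c • altSum T v := by
  simp only [altSum, Finset.smul_sum, smul_comm c]

/-- The permutation of `Fin (m + 1)` that takes `p` to `0` and the other indices, in order, to the
successors of the values of `e`. -/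
def permOfPos (x : Fin (m + 1) × Perm (Fin m)) : Perm (Fin (m + 1)) :=
  Perm.decomposeFin.symm (0, x.2) * x.1.cycleRange

lemma permOfPos_bijective : Bijective (permOfPos (m := m)) := by
  have h0 : ∀ x : Fin (m + 1) × Perm (Fin m), (permOfPos x).symm 0 = x.1 := by
    intro x
    rw [Equiv.symm_apply_eq, permOfPos, Perm.mul_apply, Fin.cycleRange_self,
      Perm.decomposeFin_symm_apply_zero]
  have hinj : Injective (permOfPos (m := m)) := by
    intro x y h
    have h1 : x.1 = y.1 := by rw [← h0 x, h, h0 y]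
    rw [permOfPos, permOfPos, h1] at h
    have h2 := Perm.decomposeFin.symm.injective (mul_right_cancel h)
    exact Prod.ext h1 (Prod.ext_iff.1 h2).2
  refine (Fintype.bijective_iff_injective_and_card _).2 ⟨hinj, ?_⟩
  simp [Fintype.card_perm, Nat.factorial_succ]

lemma sign_permOfPos (x : Fin (m + 1) × Perm (Fin m)) :
    (Perm.sign (permOfPos x) : ℤ) = (-1) ^ (x.1 : ℕ) * Perm.sign x.2 := by
  simp [permOfPos, Perm.sign_mul, Fin.sign_cycleRange, mul_comm]

lemma cons_comp_permOfPos (x : Fin (m + 1) × Perm (Fin m)) (X : L) (u : Fin m → L) :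
    (Fin.cons X u : Fin (m + 1) → L) ∘ permOfPos x = x.1.insertNth X (u ∘ x.2) := by
  rw [permOfPos, ← Fin.cons_comp_cycleRange, Perm.coe_mul, ← comp_assoc]
  congr 1
  ext i
  cases i using Fin.cases with
  | zero => simp
  | succ i => simp

/-- Expansion of an alternating sum along the position that receives the first vector. -/
lemma altSum_cons (T : (Fin (m + 1) → L) → A) (X : L) (u : Fin m → L) :
    altSum T (Fin.cons X u : Fin (m + 1) → L) =
      ∑ p : Fin (m + 1), ((-1 : ℤ) ^ (p : ℕ)) • altSum (fun w => T (p.insertNth X w)) u := by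
  rw [altSum, ← permOfPos_bijective.sum_comp, Fintype.sum_prod_type]
  refine Finset.sum_congr rfl fun p _ => ?_
  rw [altSum, Finset.smul_sum]
  refine Finset.sum_congr rfl fun e _ => ?_
  rw [cons_comp_permOfPos, sign_permOfPos, mul_smul]

end AltSum

section
variable {A L : Type*} [CommRing A] [LieRing L] [Module A L] [LieRingModule L A]
  [LieRinehartRing A L] [Algebra ℝ A] [LieAlgebra ℝ L] [LieRinehartAlgebra ℝ A L] {k l m : ℕ}

/-- The product of the values of `α` at the first `k` and of `β` at the last `l` of `N = k + l`
vectors. The equation is a parameter, so that `N` can be any expression for the degree. -/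
def tens {N : ℕ} (α : Form A L k) (β : Form A L l) (h : k + l = N) (w : Fin N → L) : A :=
  α (fun i => w (Fin.cast h (Fin.castAdd l i))) * β (fun j => w (Fin.cast h (Fin.natAdd k j)))

lemma factorial_smul_wedge (α : Form A L k) (β : Form A L l) (v : Fin (k + l) → L) :
    (k.factorial * l.factorial) • wedge α β v = altSum (tens α β rfl) v := by
  have h := DFunLike.congr_fun (MultilinearMap.domCoprod_alternization_eq α β)
    (v ∘ finSumFinEquiv)
  rw [MultilinearMap.alternatization_apply] at h
  have h2 := congrArg (LinearMap.mul' A A) h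
  simp only [map_sum, Fintype.card_fin] at h2
  have h3 : (k.factorial * l.factorial) • wedge α β v =
      LinearMap.mul' A A (((k.factorial * l.factorial) • α.domCoprod β) (v ∘ finSumFinEquiv)) := by
    rw [AlternatingMap.smul_apply, map_nsmul]; rfl
  rw [h3, ← h2, altSum, ← (Equiv.permCongr finSumFinEquiv).sum_comp]
  refine Finset.sum_congr rfl fun σ _ => ?_
  rw [Perm.sign_permCongr, Units.smul_def, map_zsmul]
  congr 1
  simp [tens, MultilinearMap.domDomCongr_apply, Equiv.permCongr_apply, comp_def]

lemma nsmul_cancel {c : ℕ} (hc : c ≠ 0) {a b : A} (h : c • a = c • b) : a = b := by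
  rw [← Nat.cast_smul_eq_nsmul ℝ, ← Nat.cast_smul_eq_nsmul ℝ] at h
  have h2 := congrArg (fun x => ((c : ℝ)⁻¹) • x) h
  simpa [smul_smul, hc] using h2

/-- A vector inserted among the arguments of `α` is moved to their front, at the cost of a sign. -/
lemma tens_insertNth_left (α : Form A L (k + 1)) (β : Form A L l) (h : k + 1 + l = m + 1)
    (h' : k + l = m) (i : Fin (k + 1)) (X : L) (w : Fin m → L) :
    tens α β h ((Fin.cast h (Fin.castAdd l i)).insertNth X w) =
      ((-1 : ℤ) ^ (i : ℕ)) • tens (contr X (k + 1) α) β h' w := by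
  have e1 : (fun j => (Fin.insertNth (α := fun _ => L) (Fin.cast h (Fin.castAdd l i)) X w)
      (Fin.cast h (Fin.castAdd l j))) =
      Fin.insertNth (α := fun _ => L) i X (fun j => w (Fin.cast h' (Fin.castAdd l j))) := by
    rw [Fin.eq_insertNth_iff]
    refine ⟨by simp, funext fun j => ?_⟩
    have : Fin.cast h (Fin.castAdd l (i.succAbove j)) =
        (Fin.cast h (Fin.castAdd l i)).succAbove (Fin.cast h' (Fin.castAdd l j)) := by
      ext; simp [Fin.succAbove, Fin.lt_def]; split_ifs <;> simp
    simp only [Fin.removeNth, this, Fin.insertNth_apply_succAbove]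
  have e2 : (fun j => (Fin.insertNth (α := fun _ => L) (Fin.cast h (Fin.castAdd l i)) X w)
      (Fin.cast h (Fin.natAdd (k + 1) j))) = fun j => w (Fin.cast h' (Fin.natAdd k j)) := by
    funext j
    have : Fin.cast h (Fin.natAdd (k + 1) j) =
        (Fin.cast h (Fin.castAdd l i)).succAbove (Fin.cast h' (Fin.natAdd k j)) := by
      ext
      have := i.2
      simp [Fin.succAbove, Fin.lt_def]; split_ifs <;> simp <;> omega
    rw [this, Fin.insertNth_apply_succAbove]
  rw [tens, e1, e2, AlternatingMap.map_insertNth, tens, smul_mul_assoc]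
  rfl

lemma tens_insertNth_right (α : Form A L k) (β : Form A L (l + 1)) (h : k + (l + 1) = m + 1)
    (h' : k + l = m) (i : Fin (l + 1)) (X : L) (w : Fin m → L) :
    tens α β h ((Fin.cast h (Fin.natAdd k i)).insertNth X w) =
      ((-1 : ℤ) ^ (i : ℕ)) • tens α (contr X (l + 1) β) h' w := by
  have e1 : (fun j => (Fin.insertNth (α := fun _ => L) (Fin.cast h (Fin.natAdd k i)) X w)
      (Fin.cast h (Fin.natAdd k j))) =
      Fin.insertNth (α := fun _ => L) i X (fun j => w (Fin.cast h' (Fin.natAdd k j))) := by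
    rw [Fin.eq_insertNth_iff]
    refine ⟨by simp, funext fun j => ?_⟩
    have : Fin.cast h (Fin.natAdd k (i.succAbove j)) =
        (Fin.cast h (Fin.natAdd k i)).succAbove (Fin.cast h' (Fin.natAdd k j)) := by
      ext; simp [Fin.succAbove, Fin.lt_def]; split_ifs <;> (simp; try omega)
    simp only [Fin.removeNth, this, Fin.insertNth_apply_succAbove]
  have e2 : (fun j => (Fin.insertNth (α := fun _ => L) (Fin.cast h (Fin.natAdd k i)) X w)
      (Fin.cast h (Fin.castAdd (l + 1) j))) = fun j => w (Fin.cast h' (Fin.castAdd l j)) := by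
    funext j
    have : Fin.cast h (Fin.castAdd (l + 1) j) =
        (Fin.cast h (Fin.natAdd k i)).succAbove (Fin.cast h' (Fin.castAdd l j)) := by
      ext
      have := j.2
      simp [Fin.succAbove, Fin.lt_def]; split_ifs <;> (simp; try omega)
    rw [this, Fin.insertNth_apply_succAbove]
  rw [tens, e1, e2, AlternatingMap.map_insertNth, tens, mul_smul_comm]
  rfl

/-! ### Components of forms of mixed degree -/

lemma Forms.induction_on {P : Forms A L → Prop} (w : Forms A L) (h0 : P 0)
    (hadd : ∀ v w, P v → P w → P (v + w))
    (hlof : ∀ k (α : Form A L k), P (DirectSum.lof ℝ ℕ (Form A L) k α)) : P w :=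
  DirectSum.induction_on w h0 hlof hadd

lemma lof_apply_self (α : Form A L k) : (DirectSum.lof ℝ ℕ (Form A L) k α) k = α :=
  DirectSum.lof_apply ℝ k α

lemma lof_apply_ne (α : Form A L k) {j : ℕ} (h : k ≠ j) :
    (DirectSum.lof ℝ ℕ (Form A L) k α) j = 0 :=
  DirectSum.of_eq_of_ne _ _ _ h.symm

lemma contrTot_lof (X : L) (α : Form A L k) :
    contrTot X (DirectSum.lof ℝ ℕ (Form A L) k α) =
      DirectSum.lof ℝ ℕ (Form A L) (k - 1) (contr X k α) :=
  DirectSum.toModule_lof ..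

lemma lieTot_lof (X : L) (α : Form A L k) :
    lieTot X (DirectSum.lof ℝ ℕ (Form A L) k α) =
      DirectSum.lof ℝ ℕ (Form A L) k (lieDeriv X α) :=
  DirectSum.toModule_lof ..

lemma dTot_lof (α : Form A L k) :
    dTot A L (DirectSum.lof ℝ ℕ (Form A L) k α) =
      DirectSum.lof ℝ ℕ (Form A L) (k + 1) (extDeriv α) :=
  DirectSum.toModule_lof ..

lemma wedgeTot_lof (α : Form A L k) (β : Form A L l) :
    wedgeTot A L (DirectSum.lof ℝ ℕ (Form A L) k α) (DirectSum.lof ℝ ℕ (Form A L) l β) =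
      DirectSum.lof ℝ ℕ (Form A L) (k + l) (wedge α β) := by
  rw [wedgeTot, DirectSum.toModule_lof, LinearMap.flip_apply, DirectSum.toModule_lof]
  rfl

lemma contrTot_lof_zero (X : L) (α : Form A L 0) :
    contrTot X (DirectSum.lof ℝ ℕ (Form A L) 0 α) = 0 := by
  rw [contrTot_lof]
  exact map_zero _

lemma contrTot_apply (X : L) (w : Forms A L) (k : ℕ) :
    (contrTot X w) k = contr X (k + 1) (w (k + 1)) := by
  induction w using Forms.induction_on with
  | h0 => rw [map_zero]; exact (map_zero _).symm
  | hadd v w hv hw => rw [map_add, DirectSum.add_apply, DirectSum.add_apply, hv, hw, map_add]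
  | hlof j α =>
    rcases j with _ | j
    · rw [contrTot_lof_zero, lof_apply_ne _ (by omega), map_zero]; rfl
    · rw [contrTot_lof]
      rcases eq_or_ne j k with rfl | h
      · rw [lof_apply_self]; exact lof_apply_self _
      · rw [lof_apply_ne α (by omega : j + 1 ≠ k + 1), map_zero]
        exact lof_apply_ne _ h

lemma contrTot_apply_apply (X : L) (w : Forms A L) (k : ℕ) (v : Fin k → L) :
    (contrTot X w) k v = w (k + 1) (Fin.cons X v : Fin (k + 1) → L) := by
  rw [contrTot_apply]; rfl

lemma lieTot_apply (X : L) (w : Forms A L) (k : ℕ) : (lieTot X w) k = lieDeriv X (w k) := by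
  have h0 : ∀ j, lieDeriv X (0 : Form A L j) = 0 := fun j => by
    have := lieDeriv_smul 0 X (0 : Form A L j); simpa using this
  induction w using Forms.induction_on with
  | h0 => rw [map_zero]; exact (h0 k).symm
  | hadd v w hv hw =>
    rw [map_add, DirectSum.add_apply, DirectSum.add_apply, hv, hw, lieDeriv_add]
  | hlof j α =>
    rw [lieTot_lof]
    rcases eq_or_ne j k with rfl | h
    · rw [lof_apply_self, lof_apply_self]
    · rw [lof_apply_ne _ h, lof_apply_ne _ h, h0]

lemma dTot_apply_zero (w : Forms A L) : (dTot A L w) 0 = 0 := by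
  induction w using Forms.induction_on with
  | h0 => rw [map_zero]; rfl
  | hadd v w hv hw => rw [map_add, DirectSum.add_apply, hv, hw, add_zero]
  | hlof j α => rw [dTot_lof, lof_apply_ne _ (by omega)]

lemma dTot_apply_succ (w : Forms A L) (k : ℕ) : (dTot A L w) (k + 1) = extDeriv (w k) := by
  have hadd' : ∀ j (α β : Form A L j), extDeriv (α + β) = extDeriv α + extDeriv β :=
    fun j α β => AlternatingMap.ext (koszul_add α β)
  have h0 : ∀ j, extDeriv (0 : Form A L j) = 0 := fun j => by
    have := hadd' j 0 0; simpa using this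
  induction w using Forms.induction_on with
  | h0 => rw [map_zero]; exact (h0 k).symm
  | hadd v w hv hw => rw [map_add, DirectSum.add_apply, DirectSum.add_apply, hv, hw, hadd']
  | hlof j α =>
    rw [dTot_lof]
    rcases eq_or_ne j k with rfl | h
    · rw [lof_apply_self, lof_apply_self]
    · rw [lof_apply_ne _ h, lof_apply_ne _ (by omega), h0]

/-! ### Contraction of a wedge product -/

lemma factorial_smul_lof_wedge (α : Form A L k) (β : Form A L l) {N : ℕ} (h : k + l = N)
    (v : Fin N → L) : (k.factorial * l.factorial) •
      (DirectSum.lof ℝ ℕ (Form A L) (k + l) (wedge α β)) N v = altSum (tens α β h) v := by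
  subst h
  rw [lof_apply_self, factorial_smul_wedge]

lemma sum_altSum_left (α : Form A L k) (β : Form A L l) (h : k + l = m + 1) (X : L)
    (v : Fin m → L) :
    ∑ i : Fin k, ((-1 : ℤ) ^ (i : ℕ)) • altSum (fun w => tens α β h
      ((Fin.cast h (Fin.castAdd l i)).insertNth X w)) v =
    (k.factorial * l.factorial) • (wedgeTot A L (contrTot X (DirectSum.lof ℝ ℕ (Form A L) k α))
      (DirectSum.lof ℝ ℕ (Form A L) l β)) m v := by
  rcases k with _ | k
  · rw [contrTot_lof_zero, map_zero]; simp
  · have h' : k + l = m := by omega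
    simp only [tens_insertNth_left α β h h', altSum_smul, smul_smul, ← mul_pow]
    rw [contrTot_lof]
    have := wedgeTot_lof (contr X (k + 1) α) β
    refine Eq.trans ?_ (congrArg (fun z : Forms A L => ((k + 1).factorial * l.factorial) • z m v)
      this).symm
    have := factorial_smul_lof_wedge (contr X (k + 1) α) β h' v
    simp only [Nat.factorial_succ, mul_assoc, mul_smul (k + 1)]
    rw [← this]
    simp

lemma sum_altSum_right (α : Form A L k) (β : Form A L l) (h : k + l = m + 1) (X : L)
    (v : Fin m → L) :
    ∑ i : Fin l, ((-1 : ℤ) ^ (i : ℕ)) • altSum (fun w => tens α β h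
      ((Fin.cast h (Fin.natAdd k i)).insertNth X w)) v =
    (k.factorial * l.factorial) • (wedgeTot A L (DirectSum.lof ℝ ℕ (Form A L) k α)
      (contrTot X (DirectSum.lof ℝ ℕ (Form A L) l β))) m v := by
  rcases l with _ | l
  · rw [contrTot_lof_zero, map_zero]; simp
  · have h' : k + l = m := by omega
    simp only [tens_insertNth_right α β h h', altSum_smul, smul_smul, ← mul_pow]
    rw [contrTot_lof]
    have := wedgeTot_lof α (contr X (l + 1) β)
    refine Eq.trans ?_ (congrArg (fun z : Forms A L => (k.factorial * (l + 1).factorial) • z m v)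
      this).symm
    have := factorial_smul_lof_wedge α (contr X (l + 1) β) h' v
    simp only [Nat.factorial_succ, mul_left_comm _ (l + 1), mul_smul (l + 1)]
    rw [← this]
    simp

lemma wedgeTot_lof_apply_ne (α : Form A L k) (b : Forms A L) (hb : ∀ l, k + l = m → b l = 0) :
    (wedgeTot A L (DirectSum.lof ℝ ℕ (Form A L) k α) b) m = 0 := by
  classical
  rw [← DirectSum.sum_support_of b, map_sum, DirectSum.sum_apply]
  refine Finset.sum_eq_zero fun l _ => ?_
  have := wedgeTot_lof α (b l)
  rcases eq_or_ne (k + l) m with h | h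
  · rw [hb l h, map_zero, map_zero]; rfl
  · exact (congrArg (fun z : Forms A L => z m) this).trans (lof_apply_ne _ h)

/-- The antiderivation rule for homogeneous forms. In the sum over all permutations that
represents `k! l! α ∧ β`, the terms in which the contracted vector is an argument of `α` give
`k! l! ι_X α ∧ β`, the others give `(-1)^k k! l! α ∧ ι_X β`. -/
lemma contrTot_wedge_lof (X : L) (α : Form A L k) (β : Form A L l) :
    contrTot X (wedgeTot A L (DirectSum.lof ℝ ℕ (Form A L) k α)
      (DirectSum.lof ℝ ℕ (Form A L) l β)) =
    wedgeTot A L (contrTot X (DirectSum.lof ℝ ℕ (Form A L) k α))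
      (DirectSum.lof ℝ ℕ (Form A L) l β) +
    ((-1 : ℝ) ^ k) • wedgeTot A L (DirectSum.lof ℝ ℕ (Form A L) k α)
      (contrTot X (DirectSum.lof ℝ ℕ (Form A L) l β)) := by
  refine DFinsupp.ext fun m => AlternatingMap.ext fun v => ?_
  refine (contrTot_apply_apply X _ m v).trans ?_
  change _ = (wedgeTot A L _ _ + _ : Forms A L) m v
  rw [DirectSum.add_apply, DirectSum.smul_apply, AlternatingMap.add_apply,
    AlternatingMap.smul_apply]
  rcases eq_or_ne (k + l) (m + 1) with h | h
  · have hf : k.factorial * l.factorial ≠ 0 :=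
      Nat.mul_ne_zero k.factorial_ne_zero l.factorial_ne_zero
    apply nsmul_cancel hf
    rw [smul_add, smul_comm _ ((-1 : ℝ) ^ k), ← sum_altSum_left α β h, ← sum_altSum_right α β h,
      wedgeTot_lof, factorial_smul_lof_wedge α β h, altSum_cons,
      ← (finCongr h).sum_comp, Fin.sum_univ_add]
    congr 1
    rw [Finset.smul_sum]
    refine Finset.sum_congr rfl fun i _ => ?_
    have e : ((-1 : ℝ) ^ k) = (((-1 : ℤ) ^ k : ℤ) : ℝ) := by simp
    rw [e, Int.cast_smul_eq_zsmul, smul_smul, ← pow_add]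
    rfl
  · have h1 : (wedgeTot A L (DirectSum.lof ℝ ℕ (Form A L) k α)
        (DirectSum.lof ℝ ℕ (Form A L) l β)) (m + 1) = 0 := by
      rw [wedgeTot_lof, lof_apply_ne _ h]
    have h2 : (wedgeTot A L (contrTot X (DirectSum.lof ℝ ℕ (Form A L) k α))
        (DirectSum.lof ℝ ℕ (Form A L) l β)) m = 0 := by
      rcases k with _ | k
      · rw [contrTot_lof_zero, map_zero]; rfl
      · rw [contrTot_lof]
        refine wedgeTot_lof_apply_ne (k := k) _ _ fun j hj => lof_apply_ne _ ?_
        omega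
    have h3 : (wedgeTot A L (DirectSum.lof ℝ ℕ (Form A L) k α)
        (contrTot X (DirectSum.lof ℝ ℕ (Form A L) l β))) m = 0 := by
      refine wedgeTot_lof_apply_ne _ _ fun j hj => ?_
      rw [contrTot_apply, lof_apply_ne _ (by omega), map_zero]
    rw [h1, h2, h3]; simp

/-- The subtraction of forms that belongs to their real vector space structure. The general instance
for direct sums of groups is not reducibly equal to it on the underlying monoid. -/
abbrev Forms.addCommGroup : AddCommGroup (Forms A L) := Module.addCommMonoidToAddCommGroup ℝ

attribute [local instance] Forms.addCommGroup

lemma Forms.sub_apply (v w : Forms A L) (k : ℕ) : (v - w) k = v k - w k := by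
  rw [eq_sub_iff_add_eq, ← DirectSum.add_apply, sub_add_cancel]

/-! ### The commutation relations of contractions and Lie derivatives -/

/-- Induction on the degree for identities between forms: if each member of a family has no
function part and its contractions are combinations of members of the family, then all members
vanish. -/
lemma Forms.family_eq_zero {ι : Type*} {D : ι → Forms A L} (h0 : ∀ i, D i 0 = 0)
    (h : ∀ i X, contrTot X (D i) ∈ Submodule.span ℝ (range D)) (i : ι) : D i = 0 := by
  have H0 : ∀ w ∈ Submodule.span ℝ (range D), w 0 = 0 := by
    intro w hw
    induction hw using Submodule.span_induction with
    | mem w hw => obtain ⟨j, rfl⟩ := hw; exact h0 j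
    | zero => rfl
    | add v w _ _ hv hw => rw [DirectSum.add_apply, hv, hw, add_zero]
    | smul c w _ hw => rw [DirectSum.smul_apply, hw, smul_zero]
  have H : ∀ w ∈ Submodule.span ℝ (range D), ∀ X, contrTot X w ∈ Submodule.span ℝ (range D) := by
    intro w hw X
    induction hw using Submodule.span_induction with
    | mem w hw => obtain ⟨j, rfl⟩ := hw; exact h j X
    | zero => rw [map_zero]; exact zero_mem _
    | add v w _ _ hv hw => rw [map_add]; exact add_mem hv hw
    | smul c w _ hw => rw [map_smul]; exact Submodule.smul_mem _ c hw
  have H2 : ∀ k, ∀ w ∈ Submodule.span ℝ (range D), w k = 0 := by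
    intro k
    induction k with
    | zero => exact H0
    | succ k ih =>
      intro w hw
      refine AlternatingMap.ext fun v => ?_
      rw [← Fin.cons_self_tail v, ← contrTot_apply_apply, ih _ (H w hw _)]
      rfl
  exact DFinsupp.ext fun k => H2 k _ (Submodule.subset_span ⟨i, rfl⟩)

lemma add_contrTot (X Y : L) (w : Forms A L) :
    contrTot (X + Y) w = contrTot X w + contrTot Y w := by
  refine DFinsupp.ext fun k => ?_
  change _ = (contrTot X w + contrTot Y w : Forms A L) k
  rw [DirectSum.add_apply, contrTot_apply, contrTot_apply, contrTot_apply]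
  exact map_add (AlternatingMap.curryLeft (w (k + 1))) X Y

lemma smul_contrTot (c : ℝ) (X : L) (w : Forms A L) :
    contrTot (c • X) w = c • contrTot X w := by
  refine DFinsupp.ext fun k => ?_
  change _ = (c • contrTot X w : Forms A L) k
  rw [DirectSum.smul_apply, contrTot_apply, contrTot_apply, ← IsScalarTower.algebraMap_smul A c X,
    smul_eq_fun]
  exact map_smul (AlternatingMap.curryLeft (w (k + 1))) (algebraMap ℝ A c) X

lemma add_lieTot (X Y : L) (w : Forms A L) :
    lieTot (X + Y) w = lieTot X w + lieTot Y w := by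
  refine DFinsupp.ext fun k => ?_
  change _ = (lieTot X w + lieTot Y w : Forms A L) k
  rw [DirectSum.add_apply, lieTot_apply, lieTot_apply, lieTot_apply, add_lieDeriv]

lemma smul_lieTot (c : ℝ) (X : L) (w : Forms A L) :
    lieTot (c • X) w = c • lieTot X w := by
  refine DFinsupp.ext fun k => ?_
  change _ = (c • lieTot X w : Forms A L) k
  rw [DirectSum.smul_apply, lieTot_apply, lieTot_apply, smul_lieDeriv]

lemma contrTot_contrTot_self (X : L) (w : Forms A L) : contrTot X (contrTot X w) = 0 := by
  refine DFinsupp.ext fun k => AlternatingMap.ext fun v => ?_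
  refine (contrTot_apply_apply X _ k v).trans ((contrTot_apply_apply X w _ _).trans ?_)
  exact AlternatingMap.map_eq_zero_of_eq _ _ (i := 0) (j := 1) rfl (by simp)

lemma contrTot_contrTot (X Y : L) (w : Forms A L) :
    contrTot X (contrTot Y w) = - contrTot Y (contrTot X w) := by
  have h := contrTot_contrTot_self (X + Y) w
  simp only [add_contrTot, map_add, contrTot_contrTot_self, zero_add, add_zero] at h
  rw [eq_neg_iff_add_eq_zero, add_comm]
  exact h

lemma contrTot_contrTot_eq_zero {X : L} (Y : L) {w : Forms A L} (h : contrTot X w = 0) :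
    contrTot X (contrTot Y w) = 0 := by
  rw [contrTot_contrTot, h, map_zero, neg_zero]

lemma lieTot_contrTot (X Y : L) (w : Forms A L) :
    lieTot X (contrTot Y w) = contrTot ⁅X, Y⁆ w + contrTot Y (lieTot X w) := by
  refine DFinsupp.ext fun k => AlternatingMap.ext fun v => ?_
  change _ = (contrTot ⁅X, Y⁆ w + contrTot Y (lieTot X w) : Forms A L) k v
  rw [DirectSum.add_apply, AlternatingMap.add_apply, lieTot_apply, lieDeriv_apply]
  simp only [contrTot_apply_apply]
  rw [lieTot_apply, lieDeriv_apply, Fin.sum_univ_succ]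
  simp only [Fin.cons_zero, Fin.cons_succ, Fin.update_cons_zero, Fin.cons_update]
  abel

lemma contrTot_lieTot (X Y : L) (w : Forms A L) :
    contrTot Y (lieTot X w) = lieTot X (contrTot Y w) - contrTot ⁅X, Y⁆ w := by
  rw [lieTot_contrTot, add_sub_cancel_left]

lemma lieTot_apply_zero (X : L) (w : Forms A L) (v : Fin 0 → L) :
    (lieTot X w) 0 v = ⁅X, w 0 v⁆ := by
  rw [lieTot_apply, lieDeriv_apply, Finset.univ_eq_empty, Finset.sum_empty, sub_zero]

lemma lieTot_lieTot (X Y : L) (w : Forms A L) :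
    lieTot X (lieTot Y w) = lieTot ⁅X, Y⁆ w + lieTot Y (lieTot X w) := by
  rw [← sub_eq_zero]
  refine Forms.family_eq_zero (D := fun p : L × L × Forms A L => lieTot p.1 (lieTot p.2.1 p.2.2) -
    (lieTot ⁅p.1, p.2.1⁆ p.2.2 + lieTot p.2.1 (lieTot p.1 p.2.2))) ?_ ?_ (X, Y, w)
  · rintro ⟨X, Y, w⟩
    refine AlternatingMap.ext fun v => ?_
    simp only [Forms.sub_apply, DirectSum.add_apply, AlternatingMap.sub_apply,
      AlternatingMap.add_apply, lieTot_apply_zero]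
    rw [leibniz_lie X Y, sub_self]; rfl
  · rintro ⟨X, Y, w⟩ Z
    refine Submodule.subset_span ⟨(X, Y, contrTot Z w), ?_⟩
    simp only [map_sub, map_add, contrTot_lieTot]
    have h := leibniz_lie X Y Z
    have h2 : contrTot ⁅X, ⁅Y, Z⁆⁆ w = contrTot ⁅⁅X, Y⁆, Z⁆ w + contrTot ⁅Y, ⁅X, Z⁆⁆ w := by
      rw [h, add_contrTot]
    rw [h2]
    abel

/-! ### Cartan's formula and the exterior derivative -/

/-- The terms of the Koszul formula for `dα(X, v₀, …)` in which `X` stays an argument of `α` are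
cancelled by those of `d(ι_X α)`; the others make up the Lie derivative. -/
lemma koszul_cons (α : Form A L (m + 1)) (X : L) (v : Fin (m + 1) → L) :
    koszul α (Fin.cons X v : Fin (m + 2) → L) + koszul (α.curryLeft X) v =
      lieDeriv X α v := by
  have hc : ∀ u : Fin m → L, α.curryLeft X u = α (Fin.cons X u : Fin (m + 1) → L) :=
    fun _ => rfl
  have hr : ∀ (Y : L) (u : Fin (m + 1) → L) (j : Fin (m + 1)),
      j.succ.removeNth (Fin.cons Y u : Fin (m + 2) → L) =
        (Fin.cons Y (j.removeNth u) : Fin (m + 1) → L) := by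
    intro Y u j
    ext i
    cases i using Fin.cases with
    | zero => simp [Fin.removeNth]
    | succ i => simp [Fin.removeNth]
  have h0 : (0 : Fin (m + 2)).removeNth (Fin.cons X v : Fin (m + 2) → L) = v := by
    ext i; simp [Fin.removeNth]
  have h1 : ∀ (j : Fin (m + 1)) (Y : L), (-1 : A) ^ (j : ℕ) *
      α (Fin.cons Y (j.removeNth v) : Fin (m + 1) → L) = α (update v j Y) := by
    intro j Y
    have := α.neg_one_pow_smul_map_insertNth j Y (j.removeNth v)
    rw [Matrix.vecCons] at this
    rw [← this, Fin.insertNth_removeNth, zsmul_eq_mul, ← mul_assoc]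
    push_cast
    rw [← mul_pow]
    simp
  simp only [koszul, lieDeriv_apply]
  rw [Fin.sum_univ_succ, Fin.sum_univ_succ (n := m + 1), Fin.sum_Ioi_zero]
  simp only [Fin.sum_Ioi_succ, Fin.cons_zero, Fin.cons_succ, Fin.update_cons_zero,
    ← Fin.cons_update, hr, h0, hc, Fin.val_succ, Fin.val_zero, pow_succ, pow_zero, one_mul,
    mul_neg, mul_one, neg_mul, Finset.sum_neg_distrib, h1]
  abel

/-- Cartan's formula. -/
lemma lieTot_eq (X : L) (w : Forms A L) :
    lieTot X w = dTot A L (contrTot X w) + contrTot X (dTot A L w) := by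
  refine DFinsupp.ext fun k => AlternatingMap.ext fun v => ?_
  change _ = (dTot A L (contrTot X w) + contrTot X (dTot A L w) : Forms A L) k v
  rw [DirectSum.add_apply, AlternatingMap.add_apply, contrTot_apply_apply, dTot_apply_succ]
  rcases k with _ | k
  · rw [dTot_apply_zero, lieTot_apply_zero]
    change _ = 0 + koszul (w 0) _
    have : (0 : Fin 1).removeNth (Fin.cons X v : Fin 1 → L) = v := Subsingleton.elim _ _
    simp [koszul, this]
  · rw [dTot_apply_succ, lieTot_apply, contrTot_apply, ← koszul_cons, add_comm]
    rfl

lemma contrTot_dTot (X : L) (w : Forms A L) :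
    contrTot X (dTot A L w) = lieTot X w - dTot A L (contrTot X w) := by
  rw [lieTot_eq, add_sub_cancel_left]

lemma lieTot_dTot (X : L) (w : Forms A L) :
    lieTot X (dTot A L w) = dTot A L (lieTot X w) := by
  rw [← sub_eq_zero]
  refine Forms.family_eq_zero (D := fun p : L × Forms A L => lieTot p.1 (dTot A L p.2) -
    dTot A L (lieTot p.1 p.2)) ?_ ?_ (X, w)
  · rintro ⟨X, w⟩
    refine AlternatingMap.ext fun v => ?_
    simp only [Forms.sub_apply, AlternatingMap.sub_apply, lieTot_apply_zero, dTot_apply_zero]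
    simp
  · rintro ⟨X, w⟩ Y
    have : contrTot Y (lieTot X (dTot A L w) - dTot A L (lieTot X w)) =
        -(lieTot X (dTot A L (contrTot Y w)) - dTot A L (lieTot X (contrTot Y w))) -
          (lieTot ⁅X, Y⁆ w + lieTot Y (lieTot X w) - lieTot X (lieTot Y w)) := by
      simp only [map_sub, contrTot_lieTot, contrTot_dTot]
      abel
    simp only
    rw [this, ← lieTot_lieTot, sub_self]
    exact sub_mem (neg_mem (Submodule.subset_span ⟨(X, contrTot Y w), rfl⟩)) (zero_mem _)

lemma dTot_dTot (w : Forms A L) : dTot A L (dTot A L w) = 0 := by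
  refine Forms.family_eq_zero (D := fun w : Forms A L => dTot A L (dTot A L w)) ?_ ?_ w
  · exact fun w => dTot_apply_zero _
  · intro w X
    refine Submodule.subset_span ⟨contrTot X w, ?_⟩
    simp only [contrTot_dTot, map_sub, lieTot_dTot]
    abel

/-! ### The algebra of forms -/

variable (A L) in
/-- The parity involution, `(-1)^k` on `k`-forms. It states the graded Leibniz rules without a
reference to the degree of the first factor. -/
def parity : Forms A L →ₗ[ℝ] Forms A L :=
  DirectSum.toModule ℝ ℕ _ fun k => ((-1 : ℝ) ^ k) • DirectSum.lof ℝ ℕ (Form A L) k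

lemma parity_lof (α : Form A L k) : parity A L (DirectSum.lof ℝ ℕ (Form A L) k α) =
    ((-1 : ℝ) ^ k) • DirectSum.lof ℝ ℕ (Form A L) k α := by
  rw [parity, DirectSum.toModule_lof]; rfl

lemma parity_parity (w : Forms A L) : parity A L (parity A L w) = w := by
  induction w using Forms.induction_on with
  | h0 => rw [map_zero, map_zero]
  | hadd v w hv hw => rw [map_add, map_add, hv, hw]
  | hlof j α => rw [parity_lof, map_smul, parity_lof, smul_smul, ← mul_pow]; simp

lemma contrTot_parity (X : L) (w : Forms A L) :
    contrTot X (parity A L w) = - parity A L (contrTot X w) := by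
  induction w using Forms.induction_on with
  | h0 => simp only [map_zero, neg_zero]
  | hadd v w hv hw => simp only [map_add, hv, hw]; abel
  | hlof j α =>
    rw [parity_lof, map_smul]
    rcases j with _ | j
    · rw [contrTot_lof_zero]; simp
    · rw [contrTot_lof, pow_succ, mul_neg_one, neg_smul]
      exact congrArg Neg.neg (parity_lof (k := j) (contr X (j + 1) α)).symm

lemma lieTot_parity (X : L) (w : Forms A L) :
    lieTot X (parity A L w) = parity A L (lieTot X w) := by
  induction w using Forms.induction_on with
  | h0 => simp only [map_zero]
  | hadd v w hv hw => simp only [map_add, hv, hw]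
  | hlof j α => rw [parity_lof, map_smul, lieTot_lof, parity_lof]

lemma dTot_parity (w : Forms A L) :
    dTot A L (parity A L w) = - parity A L (dTot A L w) := by
  induction w using Forms.induction_on with
  | h0 => simp only [map_zero, neg_zero]
  | hadd v w hv hw => simp only [map_add, hv, hw]; abel
  | hlof j α =>
    rw [parity_lof, map_smul, dTot_lof, parity_lof, pow_succ, mul_neg_one, neg_smul]
    exact (neg_neg _).symm

lemma parity_wedge (a b : Forms A L) :
    parity A L (wedgeTot A L a b) = wedgeTot A L (parity A L a) (parity A L b) := by
  induction a using Forms.induction_on with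
  | h0 => simp
  | hadd v w hv hw => simp only [map_add, LinearMap.add_apply, hv, hw]
  | hlof k α =>
    induction b using Forms.induction_on with
    | h0 => simp
    | hadd v w hv hw => simp only [map_add, hv, hw]
    | hlof l β =>
      simp only [parity_lof, map_smul, LinearMap.smul_apply, wedgeTot_lof, smul_smul, pow_add]
      rw [mul_comm]

/-- Contraction is an antiderivation of the wedge product. -/
lemma contrTot_wedge (X : L) (a b : Forms A L) :
    contrTot X (wedgeTot A L a b) = wedgeTot A L (contrTot X a) b +
      wedgeTot A L (parity A L a) (contrTot X b) := by
  induction a using Forms.induction_on with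
  | h0 => simp
  | hadd v w hv hw => simp only [map_add, LinearMap.add_apply, hv, hw]; abel
  | hlof k α =>
    induction b using Forms.induction_on with
    | h0 => simp
    | hadd v w hv hw => simp only [map_add, hv, hw]; abel
    | hlof l β => rw [contrTot_wedge_lof, parity_lof, map_smul, LinearMap.smul_apply]

lemma wedge_apply_zero (a b : Forms A L) (v : Fin 0 → L) :
    (wedgeTot A L a b) 0 v = a 0 v * b 0 v := by
  induction a using Forms.induction_on with
  | h0 => simp
  | hadd x y hx hy =>
    simp only [map_add, LinearMap.add_apply, DirectSum.add_apply, AlternatingMap.add_apply, hx, hy]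
    ring
  | hlof k α =>
    induction b using Forms.induction_on with
    | h0 => simp
    | hadd x y hx hy =>
      simp only [map_add, DirectSum.add_apply, AlternatingMap.add_apply, hx, hy]
      ring
    | hlof l β =>
      rw [wedgeTot_lof]
      rcases k with _ | k
      · rcases l with _ | l
        · have h := factorial_smul_lof_wedge α β (Nat.add_zero 0) v
          rw [altSum, Fintype.sum_unique] at h
          simp only [Nat.factorial_zero, mul_one, one_smul] at h
          rw [lof_apply_self, lof_apply_self]
          refine h.trans ?_
          have e1 : (default : Perm (Fin 0)) = 1 := rfl
          rw [e1, Perm.sign_one, Units.val_one, one_smul, tens]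
          congr 2; exact Subsingleton.elim _ _
        · rw [lof_apply_ne _ (by omega), lof_apply_ne β (by omega)]; simp
      · rw [lof_apply_ne _ (by omega), lof_apply_ne α (by omega)]; simp

lemma wedge_assoc (a b c : Forms A L) :
    wedgeTot A L (wedgeTot A L a b) c = wedgeTot A L a (wedgeTot A L b c) := by
  rw [← sub_eq_zero]
  let D : Forms A L × Forms A L × Forms A L → Forms A L := fun p =>
    wedgeTot A L (wedgeTot A L p.1 p.2.1) p.2.2 - wedgeTot A L p.1 (wedgeTot A L p.2.1 p.2.2)
  refine Forms.family_eq_zero (D := D) ?_ ?_ (a, b, c)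
  · rintro ⟨a, b, c⟩
    refine AlternatingMap.ext fun v => ?_
    simp only [D, Forms.sub_apply, AlternatingMap.sub_apply, wedge_apply_zero]
    rw [mul_assoc, sub_self]; rfl
  · rintro ⟨a, b, c⟩ X
    have h : ∀ p, D p ∈ Submodule.span ℝ (range D) :=
      fun p => Submodule.subset_span ⟨p, rfl⟩
    convert! add_mem (add_mem (h (contrTot X a, b, c)) (h (parity A L a, contrTot X b, c)))
      (h (parity A L a, parity A L b, contrTot X c)) using 1
    simp only [D, map_sub, map_add, contrTot_wedge, LinearMap.add_apply, parity_wedge]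
    abel

/-- The Lie derivative is a derivation of the wedge product. -/
lemma lieTot_wedge (X : L) (a b : Forms A L) :
    lieTot X (wedgeTot A L a b) = wedgeTot A L (lieTot X a) b + wedgeTot A L a (lieTot X b) := by
  rw [← sub_eq_zero]
  let D : L × Forms A L × Forms A L → Forms A L := fun p =>
    lieTot p.1 (wedgeTot A L p.2.1 p.2.2) - (wedgeTot A L (lieTot p.1 p.2.1) p.2.2 +
      wedgeTot A L p.2.1 (lieTot p.1 p.2.2))
  refine Forms.family_eq_zero (D := D) ?_ ?_ (X, a, b)
  · rintro ⟨X, a, b⟩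
    refine AlternatingMap.ext fun v => ?_
    simp only [D, Forms.sub_apply, DirectSum.add_apply, AlternatingMap.sub_apply,
      AlternatingMap.add_apply, wedge_apply_zero, lieTot_apply_zero,
      LieRinehartRing.leibniz_mul_right, AlternatingMap.zero_apply]
    ring
  · rintro ⟨X, a, b⟩ Y
    have h : ∀ p, D p ∈ Submodule.span ℝ (range D) :=
      fun p => Submodule.subset_span ⟨p, rfl⟩
    convert! add_mem (h (X, contrTot Y a, b)) (h (X, parity A L a, contrTot Y b)) using 1
    simp only [D, map_sub, map_add, contrTot_wedge, contrTot_lieTot, lieTot_parity, LinearMap.sub_apply]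
    abel

/-- The exterior derivative is an antiderivation of the wedge product. -/
lemma dTot_wedge (a b : Forms A L) :
    dTot A L (wedgeTot A L a b) = wedgeTot A L (dTot A L a) b +
      wedgeTot A L (parity A L a) (dTot A L b) := by
  rw [← sub_eq_zero]
  let D : Forms A L × Forms A L → Forms A L := fun p =>
    dTot A L (wedgeTot A L p.1 p.2) - (wedgeTot A L (dTot A L p.1) p.2 +
      wedgeTot A L (parity A L p.1) (dTot A L p.2))
  refine Forms.family_eq_zero (D := D) ?_ ?_ (a, b)
  · rintro ⟨a, b⟩
    refine AlternatingMap.ext fun v => ?_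
    simp only [D, Forms.sub_apply, DirectSum.add_apply, AlternatingMap.sub_apply,
      AlternatingMap.add_apply, wedge_apply_zero, dTot_apply_zero, AlternatingMap.zero_apply]
    ring
  · rintro ⟨a, b⟩ X
    have h : ∀ p, D p ∈ Submodule.span ℝ (range D) :=
      fun p => Submodule.subset_span ⟨p, rfl⟩
    convert! neg_mem (add_mem (h (contrTot X a, b)) (h (parity A L a, contrTot X b))) using 1
    simp only [D, map_sub, map_add, contrTot_wedge, contrTot_dTot,
      LinearMap.sub_apply, lieTot_wedge, contrTot_parity, dTot_parity, parity_parity, map_neg,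
      LinearMap.neg_apply]
    abel

/-- The wedge product is graded commutative. -/
lemma wedge_comm_lof (α : Form A L k) (β : Form A L l) :
    wedgeTot A L (DirectSum.lof ℝ ℕ (Form A L) k α) (DirectSum.lof ℝ ℕ (Form A L) l β) =
      ((-1 : ℝ) ^ (k * l)) • wedgeTot A L (DirectSum.lof ℝ ℕ (Form A L) l β)
        (DirectSum.lof ℝ ℕ (Form A L) k α) := by
  rw [← sub_eq_zero]
  let D : ((k : ℕ) × Form A L k) × ((l : ℕ) × Form A L l) → Forms A L := fun p =>
    wedgeTot A L (DirectSum.lof ℝ ℕ (Form A L) p.1.1 p.1.2)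
      (DirectSum.lof ℝ ℕ (Form A L) p.2.1 p.2.2) -
    ((-1 : ℝ) ^ (p.1.1 * p.2.1)) • wedgeTot A L (DirectSum.lof ℝ ℕ (Form A L) p.2.1 p.2.2)
        (DirectSum.lof ℝ ℕ (Form A L) p.1.1 p.1.2)
  refine Forms.family_eq_zero (D := D) ?_ ?_ (⟨k, α⟩, ⟨l, β⟩)
  · rintro ⟨⟨k, α⟩, ⟨l, β⟩⟩
    refine AlternatingMap.ext fun v => ?_
    simp only [D, Forms.sub_apply, DirectSum.smul_apply, AlternatingMap.sub_apply,
      AlternatingMap.smul_apply, wedge_apply_zero]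
    rcases k with _ | k
    · rw [Nat.zero_mul, pow_zero, one_smul, mul_comm, sub_self]; rfl
    · rw [lof_apply_ne α (by omega)]; simp
  · rintro ⟨⟨k, α⟩, ⟨l, β⟩⟩ X
    have h : ∀ k l α β, D (⟨k, α⟩, ⟨l, β⟩) ∈ Submodule.span ℝ (range D) :=
      fun k l α β => Submodule.subset_span ⟨(⟨k, α⟩, ⟨l, β⟩), rfl⟩
    have e : contrTot X (D (⟨k, α⟩, ⟨l, β⟩)) = D (⟨k - 1, contr X k α⟩, ⟨l, β⟩) +
        ((-1 : ℝ) ^ k) • D (⟨k, α⟩, ⟨l - 1, contr X l β⟩) := by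
      have h0 : ∀ (α : Form A L 0), contr X 0 α = 0 := fun _ => rfl
      have hs : ∀ j : ℕ, ((-1 : ℝ) ^ j) * (-1) ^ j = 1 := fun j => by rw [← mul_pow]; simp
      simp only [D, map_sub, map_smul, contrTot_wedge_lof, contrTot_lof, smul_add, smul_sub,
        smul_smul]
      rcases k with _ | k <;> rcases l with _ | l <;>
        simp only [h0, map_zero, LinearMap.zero_apply, smul_zero, Nat.zero_mul, Nat.mul_zero,
          pow_zero, add_zero, zero_add, one_mul, mul_one, one_smul, sub_self,
          Nat.add_sub_cancel]
      have e1 : ((-1 : ℝ) ^ ((k + 1) * (l + 1))) * (-1) ^ (l + 1) = (-1) ^ (k * (l + 1)) := by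
        rw [Nat.add_one_mul, pow_add, mul_assoc, hs, mul_one]
      have e2 : ((-1 : ℝ) ^ (k + 1)) * (-1) ^ ((k + 1) * l) = (-1) ^ ((k + 1) * (l + 1)) := by
        rw [Nat.mul_succ, pow_add _ ((k + 1) * l), mul_comm]
      rw [e1, e2]
      abel
    rw [e]
    exact add_mem (h _ _ _ _) (Submodule.smul_mem _ _ (h _ _ _ _))

lemma oneTot_apply_zero (v : Fin 0 → L) : (oneTot A L) 0 v = 1 := by
  rw [oneTot, lof_apply_self]; rfl

lemma contrTot_oneTot (X : L) : contrTot X (oneTot A L) = 0 := contrTot_lof_zero X _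

lemma parity_oneTot : parity A L (oneTot A L) = oneTot A L := by
  rw [oneTot, parity_lof, pow_zero, one_smul]

lemma one_wedge (a : Forms A L) : wedgeTot A L (oneTot A L) a = a := by
  rw [← sub_eq_zero]
  refine Forms.family_eq_zero (D := fun a : Forms A L => wedgeTot A L (oneTot A L) a - a) ?_ ?_ a
  · intro a
    refine AlternatingMap.ext fun v => ?_
    simp [Forms.sub_apply, wedge_apply_zero, oneTot_apply_zero]
  · intro a X
    refine Submodule.subset_span ⟨contrTot X a, ?_⟩
    simp [contrTot_wedge, contrTot_oneTot, parity_oneTot]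

lemma wedge_one (a : Forms A L) : wedgeTot A L a (oneTot A L) = a := by
  rw [← sub_eq_zero]
  refine Forms.family_eq_zero (D := fun a : Forms A L => wedgeTot A L a (oneTot A L) - a) ?_ ?_ a
  · intro a
    refine AlternatingMap.ext fun v => ?_
    simp [Forms.sub_apply, wedge_apply_zero, oneTot_apply_zero]
  · intro a X
    refine Submodule.subset_span ⟨contrTot X a, ?_⟩
    simp [contrTot_wedge, contrTot_oneTot]

/-- The Lie derivative of the constant function `1` vanishes. -/
lemma lieTot_oneTot (X : L) : lieTot X (oneTot A L) = 0 := by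
  have h := lieTot_wedge X (oneTot A L) (oneTot A L)
  rw [one_wedge, one_wedge, wedge_one] at h
  exact add_eq_left.1 h.symm

end
end LRForm

/-- A family of subspaces indexed by `ℤ` is a direct sum decomposition if its members are told apart
by components `p k`, `k : ℕ`, the `i`-th member has only the `i`-th component, and each vector is a
sum of members of nonnegative index. -/
lemma DirectSum.isInternal_of_components {B : Type*} [AddCommMonoid B] [Module ℝ B]
    {𝒜 : ℤ → Submodule ℝ B} {W : ℕ → Type*} [∀ k, AddCommMonoid (W k)] (p : ∀ k, B →+ W k)
    (hinj : ∀ a b, (∀ k, p k a = p k b) → a = b)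
    (hzero : ∀ i, ∀ a ∈ 𝒜 i, ∀ k : ℕ, (k : ℤ) ≠ i → p k a = 0)
    (hsum : ∀ a, ∃ (s : Finset ℕ) (c : ∀ k : ℕ, 𝒜 k), a = ∑ k ∈ s, (c k : B)) :
    DirectSum.IsInternal 𝒜 := by
  have key : ∀ (z : DirectSum ℤ fun i => 𝒜 i) (k : ℕ),
      p k (DirectSum.coeAddMonoidHom 𝒜 z) = p k (z k) := by
    intro z k
    induction z using DirectSum.induction_on with
    | zero => simp
    | of i a =>
      rw [DirectSum.coeAddMonoidHom_of]
      rcases eq_or_ne (k : ℤ) i with rfl | h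
      · rw [DirectSum.of_eq_same]
      · rw [DirectSum.of_eq_of_ne _ _ _ h, hzero i a a.2 k h]; simp
    | add x y hx hy => rw [map_add, map_add, hx, hy, DirectSum.add_apply, Submodule.coe_add, map_add]
  constructor
  · intro z z' h
    refine DFinsupp.ext fun i => Subtype.ext (hinj _ _ fun k => ?_)
    rcases eq_or_ne (k : ℤ) i with rfl | hk
    · rw [← key, ← key, h]
    · rw [hzero i _ (z i).2 k hk, hzero i _ (z' i).2 k hk]
  · intro a
    obtain ⟨s, c, rfl⟩ := hsum a
    exact ⟨∑ k ∈ s, DirectSum.of (fun i => 𝒜 i) (k : ℤ) (c k), by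
      rw [map_sum]; simp only [DirectSum.coeAddMonoidHom_of]⟩

namespace SingularFoliation
open DirectSum LRForm

/-! ### Basic forms -/

section
variable {n : ℕ} {M : Type u} [TopologicalSpace M]
    [ChartedSpace (EuclideanSpace ℝ (Fin n)) M] [IsManifold (𝓡 n) ∞ M]
  {F : SingularFoliation n M} {X Y : VField n M}

lemma tangentOn_univ_iff : F.TangentOn univ X ↔ ∀ x, X x ∈ F.tang x :=
  ⟨fun h x => h.2 x (mem_univ x), fun h => ⟨X.contMDiff.contMDiffOn, fun x _ => h x⟩⟩

lemma FoliateOn.lie_mem_tang (hX : F.FoliateOn univ X) (hY : ∀ x, Y x ∈ F.tang x) (x : M) :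
    ⁅X, Y⁆ x ∈ F.tang x :=
  (hX.2 Y (tangentOn_univ_iff.2 hY)).2 x (mem_univ x)

lemma FoliateOn.lie_mem_tang' (hX : F.FoliateOn univ X) (hY : ∀ x, Y x ∈ F.tang x) (x : M) :
    ⁅Y, X⁆ x ∈ F.tang x := by
  rw [← lie_skew]
  exact neg_mem (hX.lie_mem_tang hY x)

variable [T2Space M] {a b : Forms (SmoothFun n M) (VField n M)}

/-- Contractions of basic forms with foliate fields are basic. -/
lemma FoliateOn.contrTot_mem (hX : F.FoliateOn univ X) (ha : a ∈ F.basicForms) :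
    contrTot X a ∈ F.basicForms := by
  intro Y hY
  constructor
  · exact contrTot_contrTot_eq_zero X (ha Y hY).1
  · rw [lieTot_contrTot, (ha Y hY).2, map_zero, add_zero]
    exact (ha _ (hX.lie_mem_tang' hY)).1

/-- Lie derivatives of basic forms along foliate fields are basic. -/
lemma FoliateOn.lieTot_mem (hX : F.FoliateOn univ X) (ha : a ∈ F.basicForms) :
    lieTot X a ∈ F.basicForms := by
  intro Y hY
  constructor
  · have h := lieTot_contrTot X Y a
    rw [(ha Y hY).1, map_zero, (ha _ (hX.lie_mem_tang hY)).1, zero_add] at h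
    exact h.symm
  · rw [lieTot_lieTot, (ha Y hY).2, map_zero, add_zero]
    exact (ha _ (hX.lie_mem_tang' hY)).2

lemma dTot_mem (ha : a ∈ F.basicForms) : dTot (SmoothFun n M) (VField n M) a ∈ F.basicForms := by
  intro Y hY
  constructor
  · have h := lieTot_eq Y a
    rw [(ha Y hY).1, (ha Y hY).2, map_zero, zero_add] at h
    exact h.symm
  · rw [lieTot_dTot, (ha Y hY).2, map_zero]

lemma wedge_mem (ha : a ∈ F.basicForms) (hb : b ∈ F.basicForms) :
    wedgeTot (SmoothFun n M) (VField n M) a b ∈ F.basicForms := by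
  intro Y hY
  constructor
  · rw [contrTot_wedge, (ha Y hY).1, (hb Y hY).1, map_zero, map_zero, LinearMap.zero_apply,
      add_zero]
  · rw [lieTot_wedge, (ha Y hY).2, (hb Y hY).2, map_zero, map_zero, LinearMap.zero_apply, add_zero]

lemma oneTot_mem : oneTot (SmoothFun n M) (VField n M) ∈ F.basicForms :=
  fun Y _ => ⟨contrTot_oneTot Y, lieTot_oneTot Y⟩

/-- On basic forms, the contraction depends only on the field modulo fields tangent to the leaves. -/
lemma contrTot_congr (h : ∀ x, (X - Y) x ∈ F.tang x) (ha : a ∈ F.basicForms) :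
    contrTot X a = contrTot Y a := by
  rw [← sub_add_cancel X Y, add_contrTot, (ha _ h).1, zero_add]

/-- On basic forms, the Lie derivative depends only on the field modulo fields tangent to the
leaves. -/
lemma lieTot_congr (h : ∀ x, (X - Y) x ∈ F.tang x) (ha : a ∈ F.basicForms) :
    lieTot X a = lieTot Y a := by
  rw [← sub_add_cancel X Y, add_lieTot, (ha _ h).2, zero_add]

/-! ### The grading of the basic forms -/

lemma lof_apply_mem (ha : a ∈ F.basicForms) (k : ℕ) :
    lof ℝ ℕ (Form (SmoothFun n M) (VField n M)) k (a k) ∈ F.basicForms := by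
  intro Y hY
  constructor
  · rcases k with _ | k
    · exact contrTot_lof_zero Y _
    · rw [contrTot_lof, ← contrTot_apply, (ha Y hY).1]
      exact map_zero _
  · rw [lieTot_lof, ← lieTot_apply, (ha Y hY).2]
    exact map_zero _

variable {i j : ℤ}

lemma eq_lof_of_mem {a : F.basicForms} {k : ℕ} (ha : a ∈ F.basicGrading k) :
    (a : Forms (SmoothFun n M) (VField n M)) = lof ℝ ℕ (Form (SmoothFun n M) (VField n M)) k
      ((a : Forms (SmoothFun n M) (VField n M)) k) := by
  refine DFinsupp.ext fun j => ?_
  rcases eq_or_ne k j with rfl | h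
  · exact (lof_apply_self _).symm
  · exact (ha j (by exact_mod_cast h.symm)).trans (lof_apply_ne _ h).symm

lemma eq_zero_of_mem_neg {a : F.basicForms} {k : ℕ} (ha : a ∈ F.basicGrading (Int.negSucc k)) :
    a = 0 :=
  Subtype.ext (DFinsupp.ext fun j => ha j (by omega))

lemma mem_grading_of_eq_lof {a : F.basicForms} {k : ℕ}
    {α : Form (SmoothFun n M) (VField n M) k}
    (ha : (a : Forms (SmoothFun n M) (VField n M)) = lof ℝ ℕ _ k α) :
    a ∈ F.basicGrading k := fun j hj => by
  rw [ha, lof_apply_ne]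
  exact_mod_cast hj.symm

lemma parity_eq_of_mem {a : F.basicForms} (ha : a ∈ F.basicGrading i) :
    parity (SmoothFun n M) (VField n M) a =
      (i.negOnePow : ℝ) • (a : Forms (SmoothFun n M) (VField n M)) := by
  rcases i with k | k
  · rw [eq_lof_of_mem ha, parity_lof]
    simp
  · rw [eq_zero_of_mem_neg ha]
    simp

lemma wedge_mem_grading {a b c : F.basicForms} (ha : a ∈ F.basicGrading i)
    (hb : b ∈ F.basicGrading j) (hc : (c : Forms (SmoothFun n M) (VField n M)) =
      wedgeTot (SmoothFun n M) (VField n M) a b) : c ∈ F.basicGrading (i + j) := by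
  rcases i with k | k
  · rcases j with l | l
    · rw [eq_lof_of_mem ha, eq_lof_of_mem hb, wedgeTot_lof] at hc
      exact mem_grading_of_eq_lof hc
    · have : c = 0 := Subtype.ext (by rw [hc, eq_zero_of_mem_neg hb]; simp)
      rw [this]; exact zero_mem _
  · have : c = 0 := Subtype.ext (by rw [hc, eq_zero_of_mem_neg ha]; simp)
    rw [this]; exact zero_mem _

lemma wedge_comm_of_mem {a b : F.basicForms} (ha : a ∈ F.basicGrading i)
    (hb : b ∈ F.basicGrading j) : wedgeTot (SmoothFun n M) (VField n M) a b =
      ((i * j).negOnePow : ℝ) • wedgeTot (SmoothFun n M) (VField n M) b a := by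
  rcases i with k | k
  · rcases j with l | l
    · rw [eq_lof_of_mem ha, eq_lof_of_mem hb, wedge_comm_lof]
      have : (((Int.ofNat k * Int.ofNat l).negOnePow : ℤ) : ℝ) = (-1) ^ (k * l) := by
        have : Int.ofNat k * Int.ofNat l = ((k * l : ℕ) : ℤ) := by simp
        rw [this]; exact Int.cast_negOnePow_natCast ℝ _
      rw [this]
    · rw [eq_zero_of_mem_neg hb]; simp
  · rw [eq_zero_of_mem_neg ha]; simp

variable (F) in
lemma basicGrading_isInternal : IsInternal F.basicGrading := by
  refine isInternal_of_components (W := Form (SmoothFun n M) (VField n M)) (fun k =>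
    { toFun := fun w : F.basicForms => (w : Forms (SmoothFun n M) (VField n M)) k
      map_zero' := rfl
      map_add' := fun _ _ => rfl }) (fun a b h => Subtype.ext (DFinsupp.ext h))
    (fun i a ha k hk => ha k hk) fun a => ?_
  classical
  refine ⟨DFinsupp.support (a : Forms (SmoothFun n M) (VField n M)),
    fun k => ⟨⟨_, lof_apply_mem a.2 k⟩, mem_grading_of_eq_lof rfl⟩, Subtype.ext ?_⟩
  rw [Submodule.coe_sum]
  exact (DirectSum.sum_support_of (a : Forms (SmoothFun n M) (VField n M))).symm

/-! ### Representatives of transverse fields -/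

lemma foliateOn_univ_of_mem {X : (x : M) → TangentSpace (𝓡 n) x}
    (h : X ∈ F.foliateFields ⊤) : F.FoliateOn univ X := by
  obtain ⟨U, hU, _, h⟩ := h
  rwa [mem_top.1 hU] at h

lemma Represents.foliateOn {s : F.TransverseFields ⊤} (h : F.Represents X s) :
    F.FoliateOn univ X := foliateOn_univ_of_mem h.1

lemma Represents.sub_mem {s : F.TransverseFields ⊤} (h : F.Represents X s)
    (h' : F.Represents Y s) (x : M) : (X - Y) x ∈ F.tang x := by
  obtain ⟨h1, h2⟩ := h
  obtain ⟨h1', h2'⟩ := h'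
  obtain ⟨U, hU, _, h⟩ := TransverseFields.mk_eq.1 (h2.trans h2'.symm)
  rw [mem_top.1 hU] at h
  exact h.2 x (mem_univ x)

lemma Represents.add {s t : F.TransverseFields ⊤} (h : F.Represents X s)
    (h' : F.Represents Y t) : F.Represents (X + Y) (s + t) :=
  ⟨add_mem h.1 h'.1, by rw [← h.2, ← h'.2, ← map_add]; rfl⟩

lemma Represents.smul {s : F.TransverseFields ⊤} (c : ℝ) (h : F.Represents X s) :
    F.Represents (c • X) (c • s) :=
  ⟨Submodule.smul_mem _ c h.1, by rw [← h.2, ← map_smul]; rfl⟩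

lemma Represents.lie {s t : F.TransverseFields ⊤} (h : F.Represents X s)
    (h' : F.Represents Y t) : F.Represents ⁅X, Y⁆ ⁅s, t⁆ :=
  ⟨(TransverseFields.bracket ⟨X, h.1⟩ ⟨Y, h'.1⟩).2, by
    rw [← h.2, ← h'.2, TransverseFields.mk_lie]; rfl⟩

lemma exists_represents (s : F.TransverseFields ⊤) : ∃ X : VField n M, F.Represents X s := by
  obtain ⟨X, rfl⟩ := TransverseFields.mk_surjective s
  exact ⟨⟨X.1, contMDiffOn_univ.1 (foliateOn_univ_of_mem X.2).1⟩, X.2, rfl⟩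

/-- A foliate vector field that represents the transverse field `s`. -/
def representative (s : F.TransverseFields ⊤) : VField n M := (exists_represents s).choose

lemma represents_representative (s : F.TransverseFields ⊤) :
    F.Represents (representative s) s := (exists_represents s).choose_spec

variable (F) in
/-- The contraction of basic forms with transverse fields. -/
def basicContr : F.TransverseFields ⊤ →ₗ[ℝ] F.basicForms →ₗ[ℝ] F.basicForms :=
  LinearMap.mk₂ ℝ (fun s a => ⟨contrTot (representative s) a,
      (represents_representative s).foliateOn.contrTot_mem a.2⟩)
    (fun s t a => Subtype.ext <| (contrTot_congr (Represents.sub_mem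
      (represents_representative (s + t))
      ((represents_representative s).add (represents_representative t))) a.2).trans
        (add_contrTot _ _ _))
    (fun c s a => Subtype.ext <| (contrTot_congr (Represents.sub_mem
      (represents_representative (c • s)) ((represents_representative s).smul c)) a.2).trans
        (smul_contrTot _ _ _))
    (fun _ _ _ => Subtype.ext (map_add _ _ _))
    (fun _ _ _ => Subtype.ext (map_smul _ _ _))

variable (F) in
/-- The Lie derivative of basic forms along transverse fields. -/
def basicLie : F.TransverseFields ⊤ →ₗ[ℝ] F.basicForms →ₗ[ℝ] F.basicForms :=
  LinearMap.mk₂ ℝ (fun s a => ⟨lieTot (representative s) a,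
      (represents_representative s).foliateOn.lieTot_mem a.2⟩)
    (fun s t a => Subtype.ext <| (lieTot_congr (Represents.sub_mem
      (represents_representative (s + t))
      ((represents_representative s).add (represents_representative t))) a.2).trans
        (add_lieTot _ _ _))
    (fun c s a => Subtype.ext <| (lieTot_congr (Represents.sub_mem
      (represents_representative (c • s)) ((represents_representative s).smul c)) a.2).trans
        (smul_lieTot _ _ _))
    (fun _ _ _ => Subtype.ext (map_add _ _ _))
    (fun _ _ _ => Subtype.ext (map_smul _ _ _))

lemma basicContr_eq {s : F.TransverseFields ⊤} (h : F.Represents X s) (a : F.basicForms) :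
    (F.basicContr s a : Forms (SmoothFun n M) (VField n M)) = contrTot X a :=
  contrTot_congr ((represents_representative s).sub_mem h) a.2

lemma basicLie_eq {s : F.TransverseFields ⊤} (h : F.Represents X s) (a : F.basicForms) :
    (F.basicLie s a : Forms (SmoothFun n M) (VField n M)) = lieTot X a :=
  lieTot_congr ((represents_representative s).sub_mem h) a.2

lemma basicLie_basicLie {s t u : F.TransverseFields ⊤} (hu : ⁅s, t⁆ = u) (a : F.basicForms) :
    F.basicLie s (F.basicLie t a) = F.basicLie u a + F.basicLie t (F.basicLie s a) := by
  subst hu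
  have hs := represents_representative s
  have ht := represents_representative t
  refine Subtype.ext ?_
  rw [Submodule.coe_add, basicLie_eq hs, basicLie_eq ht, basicLie_eq ht, basicLie_eq hs,
    basicLie_eq (hs.lie ht), lieTot_lieTot]

lemma basicLie_basicContr {s t u : F.TransverseFields ⊤} (hu : ⁅s, t⁆ = u) (a : F.basicForms) :
    F.basicLie s (F.basicContr t a) = F.basicContr u a + F.basicContr t (F.basicLie s a) := by
  subst hu
  have hs := represents_representative s
  have ht := represents_representative t
  refine Subtype.ext ?_
  rw [Submodule.coe_add, basicLie_eq hs, basicContr_eq ht, basicContr_eq ht, basicLie_eq hs,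
    basicContr_eq (hs.lie ht), lieTot_contrTot]

/-! ### The `𝔤⋆`-algebra of basic forms -/

variable (F) in
/-- The wedge product of basic forms. -/
def basicWedge : F.basicForms →ₗ[ℝ] F.basicForms →ₗ[ℝ] F.basicForms :=
  LinearMap.mk₂ ℝ (fun a b => ⟨wedgeTot (SmoothFun n M) (VField n M) a b, wedge_mem a.2 b.2⟩)
    (fun _ _ _ => Subtype.ext (LinearMap.map_add₂ _ _ _ _))
    (fun _ _ _ => Subtype.ext (LinearMap.map_smul₂ _ _ _ _))
    (fun _ _ _ => Subtype.ext (map_add _ _ _))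
    (fun _ _ _ => Subtype.ext (map_smul _ _ _))

variable (F) in
/-- The exterior derivative of basic forms. -/
def basicD : F.basicForms →ₗ[ℝ] F.basicForms :=
  (dTot (SmoothFun n M) (VField n M)).restrict fun _ => dTot_mem

lemma coe_basicD (a : F.basicForms) : (F.basicD a : Forms (SmoothFun n M) (VField n M)) =
    dTot (SmoothFun n M) (VField n M) a := rfl

/-- A transverse action of a Lie algebra makes the basic forms a `𝔤⋆`-algebra. -/
def basicGStarAlgebra {𝔤 : Type*} [LieRing 𝔤] [LieAlgebra ℝ 𝔤]
    (μ : 𝔤 →ₗ⁅ℝ⁆ F.TransverseFields ⊤) : GStarAlgebra 𝔤 F.basicForms F.basicGrading where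
  mul := F.basicWedge
  one := ⟨_, oneTot_mem⟩
  d := F.basicD
  lie := F.basicLie.comp (μ : 𝔤 →ₗ[ℝ] F.TransverseFields ⊤)
  contr := F.basicContr.comp (μ : 𝔤 →ₗ[ℝ] F.TransverseFields ⊤)
  isInternal := F.basicGrading_isInternal
  one_mem := mem_grading_of_eq_lof (k := 0) rfl
  mul_mem ha hb := wedge_mem_grading ha hb rfl
  one_mul a := Subtype.ext (one_wedge _)
  mul_one a := Subtype.ext (wedge_one _)
  mul_assoc a b c := Subtype.ext (wedge_assoc _ _ _)
  mul_comm ha hb := Subtype.ext (wedge_comm_of_mem ha hb)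
  d_mem := by
    intro i a ha k hk
    rw [coe_basicD]
    rcases k with _ | k
    · exact dTot_apply_zero _
    · have h0 : ((dTot (SmoothFun n M) (VField n M)) 0) (k + 1) = LRForm.extDeriv 0 :=
        dTot_apply_succ 0 k
      rw [dTot_apply_succ, ha k (by push_cast at hk; omega), ← h0, map_zero]
      rfl
  d_d a := Subtype.ext (dTot_dTot _)
  d_mul := by
    intro i a ha b
    refine Subtype.ext ((dTot_wedge _ _).trans ?_)
    rw [parity_eq_of_mem ha, map_smul]
    rfl
  lie_mem := by
    intro X i a ha k hk
    refine (lieTot_apply _ _ k).trans ?_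
    have h0 := lieTot_apply (representative (μ X)) (0 : Forms (SmoothFun n M) (VField n M)) k
    rw [ha k hk]
    rw [map_zero] at h0
    exact h0.symm
  lie_mul X a b := Subtype.ext (lieTot_wedge _ _ _)
  contr_mem := by
    intro X i a ha k hk
    refine (contrTot_apply _ _ k).trans ?_
    rw [ha (k + 1) (by push_cast; omega), map_zero]
  contr_mul := by
    intro X i a ha b
    refine Subtype.ext ((contrTot_wedge _ _ _).trans ?_)
    rw [parity_eq_of_mem ha, map_smul]
    rfl
  contr_contr X a := Subtype.ext (contrTot_contrTot_self _ _)
  lie_lie X Y a := basicLie_basicLie (μ.map_lie X Y).symm a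
  lie_contr X Y a := basicLie_basicContr (μ.map_lie X Y).symm a
  cartan X a := Subtype.ext (lieTot_eq _ _)

/-! ### Global sections of the Molino sheaf -/

namespace TransverseFields

lemma restrict_mem_molinoSections {s : F.TransverseFields ⊤} (hs : s ∈ F.molinoSections ⊤)
    (x : M) : restrict (le_top : 𝓝 x ≤ ⊤) s ∈ F.molinoSections (𝓝 x) := by
  obtain ⟨X, rfl, U, hU, h⟩ := hs
  exact ⟨Submodule.inclusion (foliateFields_mono le_top) X, rfl, U, le_top (a := 𝓝 x) hU, h⟩

lemma restrict_mk_eq {X Y : F.foliateFields ⊤} {x : M} :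
    restrict (le_top : 𝓝 x ≤ ⊤) (mk F ⊤ X) = restrict (le_top : 𝓝 x ≤ ⊤) (mk F ⊤ Y) ↔
      ∃ U ∈ 𝓝 x, IsOpen U ∧ F.TangentOn U ((X : (x : M) → TangentSpace (𝓡 n) x) - Y) :=
  mk_eq (X := Submodule.inclusion (foliateFields_mono le_top) X)
    (Y := Submodule.inclusion (foliateFields_mono le_top) Y)

lemma isOpen_restrict_eq (s t : F.TransverseFields ⊤) :
    IsOpen {x : M | restrict (le_top : 𝓝 x ≤ ⊤) s = restrict (le_top : 𝓝 x ≤ ⊤) t} := by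
  obtain ⟨X, rfl⟩ := mk_surjective s
  obtain ⟨Y, rfl⟩ := mk_surjective t
  refine isOpen_iff_mem_nhds.2 fun x hx => ?_
  obtain ⟨U, hU, hU', h⟩ := restrict_mk_eq.1 hx
  exact mem_of_superset hU fun y hy => restrict_mk_eq.2 ⟨U, hU'.mem_nhds hy, hU', h⟩

lemma eq_of_restrict_eq {s t : F.TransverseFields ⊤}
    (h : ∀ x : M, restrict (le_top : 𝓝 x ≤ ⊤) s = restrict (le_top : 𝓝 x ≤ ⊤) t) : s = t := by
  obtain ⟨X, rfl⟩ := mk_surjective s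
  obtain ⟨Y, rfl⟩ := mk_surjective t
  refine mk_eq.2 ⟨univ, univ_mem, isOpen_univ, fun x _ => ?_, fun x _ => ?_⟩
  · obtain ⟨U, hU, hU', h'⟩ := restrict_mk_eq.1 (h x)
    exact (h'.1.at hU' (mem_of_mem_nhds hU)).contMDiffWithinAt
  · obtain ⟨U, hU, hU', h'⟩ := restrict_mk_eq.1 (h x)
    exact h'.2 x (mem_of_mem_nhds hU)

end TransverseFields

/-- If a space `Z` of global sections of the Molino sheaf is mapped bijectively to each stalk and
`M` is connected, then every global section belongs to `Z`: the points at which a section has the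
same germ as a fixed element of `Z` form a clopen set. -/
lemma mem_of_bijOn_stalks [ConnectedSpace M] {Z : Set (F.TransverseFields ⊤)}
    (hZ : ∀ x : M, BijOn (TransverseFields.restrict (le_top : 𝓝 x ≤ ⊤)) Z (F.molinoSections (𝓝 x)))
    {s : F.TransverseFields ⊤} (hs : s ∈ F.molinoSections ⊤) : s ∈ Z := by
  obtain ⟨x₀⟩ := (inferInstance : Nonempty M)
  obtain ⟨z₀, hz₀, h₀⟩ := (hZ x₀).surjOn (TransverseFields.restrict_mem_molinoSections hs x₀)
  have hcl : IsClosed {x : M | TransverseFields.restrict (le_top : 𝓝 x ≤ ⊤) z₀ = TransverseFields.restrict (le_top : 𝓝 x ≤ ⊤) s} := by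
    refine ⟨isOpen_iff_mem_nhds.2 fun y hy => ?_⟩
    obtain ⟨z, hz, h⟩ := (hZ y).surjOn (TransverseFields.restrict_mem_molinoSections hs y)
    refine mem_of_superset ((TransverseFields.isOpen_restrict_eq z s).mem_nhds h) fun y' hy' hy'' => hy ?_
    have : z = z₀ := (hZ y').injOn hz hz₀ (Eq.trans hy' (Eq.symm hy''))
    exact this ▸ h
  have huniv := IsClopen.eq_univ ⟨hcl, TransverseFields.isOpen_restrict_eq z₀ s⟩ ⟨x₀, h₀⟩
  have : z₀ = s := TransverseFields.eq_of_restrict_eq fun x => (eq_univ_iff_forall.1 huniv x :)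
  exact this ▸ hz₀

/-- The structural algebra acts transversely. Its bracket is opposite to that of the stalk, so a
homomorphism is obtained from the extension of germs to global sections by a change of sign. -/
lemma exists_transverse_action [ConnectedSpace M] {Z : LieSubalgebra ℝ (F.TransverseFields ⊤)}
    (hZm : (Z : Set (F.TransverseFields ⊤)) ⊆ F.molinoSections ⊤)
    (hZ : ∀ x : M, BijOn (TransverseFields.restrict (le_top : 𝓝 x ≤ ⊤)) Z (F.molinoSections (𝓝 x)))
    {𝔞 : Type*} [LieRing 𝔞] [LieAlgebra ℝ 𝔞] (h𝔞 : F.IsStructuralAlgebra 𝔞) :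
    ∃ μ : 𝔞 →ₗ⁅ℝ⁆ F.TransverseFields ⊤,
      Function.Injective μ ∧ Set.range μ = F.molinoSections ⊤ := by
  obtain ⟨x, -, j, hj, hjr, hjl⟩ := h𝔞
  have hex : ∀ a, ∃ z ∈ Z, TransverseFields.restrict (le_top : 𝓝 x ≤ ⊤) z = j a := fun a =>
    (hZ x).surjOn (hjr ▸ mem_range_self a)
  choose z hz hzj using hex
  have huniq : ∀ {s t}, s ∈ Z → t ∈ Z →
      TransverseFields.restrict (le_top : 𝓝 x ≤ ⊤) s = TransverseFields.restrict (le_top : 𝓝 x ≤ ⊤) t → s = t :=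
    fun hs ht h => (hZ x).injOn hs ht h
  refine ⟨{ toFun := fun a => - z a, map_add' := ?_, map_smul' := ?_, map_lie' := ?_ }, ?_, ?_⟩
  · intro a b
    rw [← neg_add]
    exact congrArg Neg.neg (huniq (hz _) (add_mem (hz a) (hz b))
      (by rw [map_add, hzj, hzj, hzj, map_add]))
  · intro c a
    rw [RingHom.id_apply, smul_neg]
    exact congrArg Neg.neg (huniq (hz _) (Z.smul_mem c (hz a))
      (by rw [map_smul, hzj, hzj, map_smul]))
  · intro a b
    refine huniq (neg_mem (hz _)) (Z.lie_mem (neg_mem (hz a)) (neg_mem (hz b))) ?_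
    rw [neg_lie, lie_neg, neg_neg, map_neg, LieHom.map_lie, hzj, hzj, hzj, hjl, lie_skew]
  · intro a b h
    have h' : z a = z b := neg_injective h
    exact hj (by rw [← hzj, ← hzj, h'])
  · refine Subset.antisymm ?_ fun s hs => ?_
    · rintro _ ⟨a, rfl⟩
      exact hZm (neg_mem (hz a))
    · have hsZ : s ∈ Z := mem_of_bijOn_stalks hZ hs
      obtain ⟨a, ha⟩ : TransverseFields.restrict (le_top : 𝓝 x ≤ ⊤) (-s) ∈ range j := by
        rw [hjr]
        exact (hZ x).mapsTo (neg_mem hsZ)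
      refine ⟨a, ?_⟩
      have : z a = -s := huniq (hz a) (neg_mem hsZ) ((hzj a).trans ha)
      change - z a = s
      rw [this, neg_neg]

end
end SingularFoliation

end

theorem proposition10p3 {n : ℕ} {M : Type u} [MetricSpace M]
    [ChartedSpace (EuclideanSpace ℝ (Fin n)) M] [IsManifold (𝓡 n) ∞ M]
    [RiemannianBundle (fun x : M => TangentSpace (𝓡 n) x)]
    [IsContMDiffRiemannianBundle (𝓡 n) ∞ (EuclideanSpace ℝ (Fin n))
      (fun x : M => TangentSpace (𝓡 n) x)]
    [IsRiemannianManifold (𝓡 n) M] [CompleteSpace M] [ConnectedSpace M]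
    [SecondCountableTopology M]
    (F : SingularFoliation n M) (hF : F.IsSingularKilling)
    (𝔞 : Type*) [LieRing 𝔞] [LieAlgebra ℝ 𝔞] (h𝔞 : F.IsStructuralAlgebra 𝔞) :
    (∃ μ : 𝔞 →ₗ⁅ℝ⁆ F.TransverseFields ⊤,
      Function.Injective μ ∧ Set.range μ = F.molinoSections ⊤) ∧
    ∀ μ : 𝔞 →ₗ⁅ℝ⁆ F.TransverseFields ⊤,
      Function.Injective μ → Set.range μ = F.molinoSections ⊤ →
      ∃ S : GStarAlgebra 𝔞 F.basicForms F.basicGrading,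
        (∀ a b : F.basicForms, (S.mul a b : LRForm.Forms (SmoothFun n M) (VField n M)) =
          LRForm.wedgeTot (SmoothFun n M) (VField n M) a b) ∧
        ((S.one : LRForm.Forms (SmoothFun n M) (VField n M)) = LRForm.oneTot (SmoothFun n M) (VField n M)) ∧
        (∀ a : F.basicForms, (S.d a : LRForm.Forms (SmoothFun n M) (VField n M)) =
          LRForm.dTot (SmoothFun n M) (VField n M) a) ∧
        ∀ (x : 𝔞) (X : VField n M), F.Represents X (μ x) → ∀ a : F.basicForms,
          (S.lie x a : LRForm.Forms (SmoothFun n M) (VField n M)) = LRForm.lieTot X a ∧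
          (S.contr x a : LRForm.Forms (SmoothFun n M) (VField n M)) = LRForm.contrTot X a := by
  obtain ⟨Z, hZm, hZ⟩ := hF.constant
  refine ⟨SingularFoliation.exists_transverse_action hZm hZ h𝔞, fun μ _ _ => ?_⟩
  exact ⟨SingularFoliation.basicGStarAlgebra μ, fun _ _ => rfl, rfl, fun _ => rfl,
    fun x X hX a => ⟨SingularFoliation.basicLie_eq hX a, SingularFoliation.basicContr_eq hX a⟩⟩
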